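/- Let $N\ge 0$ and $\omega=(\omega_1,\dots,\omega_N)\in\mathbb R^N$. For $0\le a\le b\le N$ put $\omega_{ab}=\omega_{a+1}\omega_{a+2}\cdots\omega_b$ (so $\omega_{aa}=1$), and let $e_{ab}$ ($0\le a,b\le N$) be the matrix units of size $N+1$. Let $su_\omega(N+1)$ be the real Lie algebra generated (under the matrix commutator) by the complex matrices $$J_{ab}=-\omega_{ab}e_{ab}+e_{ba},\qquad M_{ab}=i(\omega_{ab}e_{ab}+e_{ba})\quad(0\le a<b\le N),\qquad B_l=i(e_{l-1,l-1}-e_{ll})\quad(1\le l\le N),$$ and let $u_\omega(N+1)$ be the real Lie algebra generated by these matrices together with $i$ times the identity matrix. For a real Lie algebra $\mathcal G$ let $H^2(\mathcal G,\mathbb R)$ be its second cohomology group with coefficients in the trivial module $\mathbb R$ (2-cocycles modulo 2-coboundaries). Let $n$ be the number of indices $k\in\{1,\dots,N\}$ with $\omega_k=0$. Then $$\dim H^2(su_\omega(N+1),\mathbb R)=\frac{n(n+1)}2,\qquad \dim H^2(u_\omega(N+1),\mathbb R)=\frac{n(n+3)}2 .$$ In particular, for all integers $p,q\ge 0$ let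 $u(p,q)$ be the real Lie algebra of complex matrices $X$ of size $p+q$ with $X^\dagger I_{p,q}+I_{p,q}X=0$, where $I_{p,q}=\mathrm{diag}(1,\dots,1,-1,\dots,-1)$ has $p$ entries $1$ and $q$ entries $-1$; let $su(p,q)$ be the subalgebra of traceless matrices in $u(p,q)$; and let $iu(p,q)=\mathbb C^{p+q}\rtimes u(p,q)$ be the semidirect sum of the abelian real Lie algebra $\mathbb C^{p+q}$ and $u(p,q)$, which acts on it by multiplication of column vectors. Then $H^2(su(p,q),\mathbb R)=0$ and $H^2(u(p,q),\mathbb R)=0$ for all $p,q\ge 0$, and $\dim H^2(iu(p,q),\mathbb R)=1$ for all $p,q\ge 0$ with $p+q\ge 1$. -/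

import Mathlib

set_option maxSynthPendingDepth 3

open scoped Matrix

attribute [local instance 100] LieRing.ofAssociativeRing

noncomputable section

namespace UnitaryCK

/-- The second cohomology of a real Lie algebra `L` with coefficients in the trivial module `ℝ`:
the space of 2-cocycles modulo the 2-coboundaries. -/
abbrev H2 (L : Type) [LieRing L] [LieAlgebra ℝ L] : Type :=
  LieModule.Cohomology.twoCocycle ℝ L (TrivialLieModule ℝ L ℝ) ⧸
    (LinearMap.range (LieModule.Cohomology.d₁₂ ℝ L (TrivialLieModule ℝ L ℝ))).comap
      (LieModule.Cohomology.twoCocycle ℝ L (TrivialLieModule ℝ L ℝ)).subtype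

section CayleyKlein

variable {N : ℕ}

/-- The two-index coefficient `ω_{ab} = ω_{a+1} ω_{a+2} ⋯ ω_b` for `a ≤ b` (so `ω_{aa} = 1`).
The parameters `ω_1, …, ω_N` are stored with a shifted index: `ω k` stands for `ω_{k+1}`. -/
def omega (ω : Fin N → ℝ) (a b : Fin (N + 1)) : ℝ :=
  ∏ k : Fin N, if (a : ℕ) ≤ k ∧ (k : ℕ) < b then ω k else 1

/-- `J_{ab} = -ω_{ab} e_{ab} + e_{ba}`. -/
def genJ (ω : Fin N → ℝ) (a b : Fin (N + 1)) : Matrix (Fin (N + 1)) (Fin (N + 1)) ℂ :=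
  -Matrix.single a b (omega ω a b : ℂ) + Matrix.single b a 1

/-- `M_{ab} = i (ω_{ab} e_{ab} + e_{ba})`. -/
def genM (ω : Fin N → ℝ) (a b : Fin (N + 1)) : Matrix (Fin (N + 1)) (Fin (N + 1)) ℂ :=
  Complex.I • (Matrix.single a b (omega ω a b : ℂ) + Matrix.single b a 1)

/-- `B_l = i (e_{l-1,l-1} - e_{ll})`, `l = 1, …, N`; again `l : Fin N` stands for `l + 1`. -/
def genB (l : Fin N) : Matrix (Fin (N + 1)) (Fin (N + 1)) ℂ :=
  Complex.I • (Matrix.single l.castSucc l.castSucc 1 - Matrix.single l.succ l.succ 1)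

/-- The generators `J_{ab}`, `M_{ab}` (`a < b`) and `B_l` of the special unitary
Cayley--Klein algebra. -/
def generators (ω : Fin N → ℝ) : Set (Matrix (Fin (N + 1)) (Fin (N + 1)) ℂ) :=
  {X | ∃ a b : Fin (N + 1), a < b ∧ (X = genJ ω a b ∨ X = genM ω a b)} ∪ Set.range genB

/-- The special unitary Cayley--Klein algebra `su_ω(N+1)`: the real Lie algebra generated by the
matrices `J_{ab}`, `M_{ab}` (`a < b`) and `B_l`. -/
def su (ω : Fin N → ℝ) : LieSubalgebra ℝ (Matrix (Fin (N + 1)) (Fin (N + 1)) ℂ) :=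
  LieSubalgebra.lieSpan ℝ _ (generators ω)

/-- The unitary Cayley--Klein algebra `u_ω(N+1)`: the real Lie algebra generated by the matrices
`J_{ab}`, `M_{ab}` (`a < b`), `B_l` and `i` times the identity matrix. -/
def u (ω : Fin N → ℝ) : LieSubalgebra ℝ (Matrix (Fin (N + 1)) (Fin (N + 1)) ℂ) :=
  LieSubalgebra.lieSpan ℝ _
    (insert (Complex.I • (1 : Matrix (Fin (N + 1)) (Fin (N + 1)) ℂ)) (generators ω))

end CayleyKlein

section PseudoUnitary

/-- The pseudo-unitary algebra `u(p,q)`: the complex matrices `X` of size `p + q` with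
`X† I + I X = 0`, where `I = diag(1, …, 1, -1, …, -1)`. -/
def uPQ (p q : ℕ) : LieSubalgebra ℝ (Matrix (Fin p ⊕ Fin q) (Fin p ⊕ Fin q) ℂ) where
  carrier := {X | Xᴴ * LieAlgebra.Orthogonal.indefiniteDiagonal (Fin p) (Fin q) ℂ +
    LieAlgebra.Orthogonal.indefiniteDiagonal (Fin p) (Fin q) ℂ * X = 0}
  zero_mem' := by simp
  add_mem' {X Y} hX hY := by
    simp only [Set.mem_ofPred_eq] at hX hY ⊢
    rw [Matrix.conjTranspose_add, add_mul, mul_add, add_add_add_comm, hX, hY, add_zero]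
  smul_mem' c X hX := by
    simp only [Set.mem_ofPred_eq] at hX ⊢
    rw [Matrix.conjTranspose_smul, star_trivial, smul_mul_assoc, mul_smul_comm, ← smul_add, hX,
      smul_zero]
  lie_mem' {X Y} hX hY := by
    simp only [Set.mem_ofPred_eq] at hX hY ⊢
    have hX' := eq_neg_of_add_eq_zero_left hX
    have hY' := eq_neg_of_add_eq_zero_left hY
    rw [LieRing.of_associative_ring_bracket, Matrix.conjTranspose_sub, Matrix.conjTranspose_mul,
      Matrix.conjTranspose_mul, sub_mul, mul_assoc, mul_assoc, hX', hY', mul_neg, mul_neg,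
      ← mul_assoc, ← mul_assoc, hX', hY']
    noncomm_ring

/-- The special pseudo-unitary algebra `su(p,q)`: the traceless matrices in `u(p,q)`. -/
def suPQ (p q : ℕ) : LieSubalgebra ℝ (Matrix (Fin p ⊕ Fin q) (Fin p ⊕ Fin q) ℂ) where
  carrier := {X | X ∈ uPQ p q ∧ X.trace = 0}
  zero_mem' := ⟨zero_mem _, by simp⟩
  add_mem' hX hY := ⟨add_mem hX.1 hY.1, by rw [Matrix.trace_add, hX.2, hY.2, add_zero]⟩
  smul_mem' c X hX := ⟨(uPQ p q).smul_mem c hX.1, by rw [Matrix.trace_smul, hX.2, smul_zero]⟩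
  lie_mem' {X Y} hX hY := ⟨(uPQ p q).lie_mem hX.1 hY.1, by
    rw [LieRing.of_associative_ring_bracket, Matrix.trace_sub, Matrix.trace_mul_comm, sub_self]⟩

/-- The natural action of `u(p,q)` on the abelian Lie algebra of column vectors, `X · v = X v`
(as derivations: every linear map is a derivation of an abelian Lie algebra). -/
def vectorAction (p q : ℕ) :
    uPQ p q →ₗ⁅ℝ⁆ LieDerivation ℝ (Fin p ⊕ Fin q → ℂ) (Fin p ⊕ Fin q → ℂ) where
  toFun X :=
    { toFun := fun v => X.1 *ᵥ v
      map_add' := fun v w => Matrix.mulVec_add _ v w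
      map_smul' := fun c v => Matrix.mulVec_smul _ c v
      leibniz' := fun v w => by
        change X.1 *ᵥ ⁅v, w⁆ = ⁅v, X.1 *ᵥ w⁆ - ⁅w, X.1 *ᵥ v⁆
        simp [LieRing.of_associative_ring_bracket, mul_comm] }
  map_add' X Y := by
    ext1 v
    exact Matrix.add_mulVec X.1 Y.1 v
  map_smul' c X := by
    ext1 v
    exact Matrix.smul_mulVec c X.1 v
  map_lie' {X Y} := by
    ext1 v
    change (X.1 * Y.1 - Y.1 * X.1) *ᵥ v = X.1 *ᵥ (Y.1 *ᵥ v) - Y.1 *ᵥ (X.1 *ᵥ v)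
    rw [Matrix.sub_mulVec, Matrix.mulVec_mulVec, Matrix.mulVec_mulVec]

/-- The inhomogeneous pseudo-unitary algebra `iu(p,q)`: the semidirect sum of the abelian algebra
`ℂ^{p+q}` (of real dimension `2(p+q)`) and `u(p,q)`, acting on it in the natural way. -/
abbrev IU (p q : ℕ) : Type :=
  LieAlgebra.SemiDirectSum (Fin p ⊕ Fin q → ℂ) (uPQ p q) (vectorAction p q)

end PseudoUnitary

end UnitaryCK

end

/-! Both families are one algebra `ck ω μ`: the matrices with `X a b = -ω_{ab} * conj (X b a)` for
`a ≤ b`, traceless if `μ = 1/(N+1)` (giving `su`) and without trace condition if `μ = 0` (giving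
`u`). These are the two roots of `μ * (1 - μ * (N + 1)) = 0`. It is the sum of the diagonal part and
of one real plane, a copy of `ℂ`, for each pair `a < b`; the diagonal elements rotate each plane at
the speed given by its root.

Upper bound: a diagonal element `h` with distinct positive speeds allows a cocycle to be corrected
by a coboundary so that `h` is orthogonal to all planes. The cocycle identity with `h` then makes
distinct planes orthogonal to each other and to the diagonal (`IsCocycle.isNormal`). What remains is
one area factor per plane and an alternating form on the diagonal. The factors are determined by
those of the simple planes (`IsCocycle.planeValue_add`). If `ω_l ≠ 0`, the bracket on the simple
plane `l` is a nonzero multiple of the coroot `l`, so its factor is removed by a coboundary and the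
coroot is orthogonal to the diagonal (`IsCocycle.cartan_coroot`). There survive the factors with
`ω_l = 0` and the values on pairs of coroots with vanishing parameter, where for `u` the last coroot
counts as well.

Lower bound: every surviving value is taken on a commuting pair, where coboundaries vanish, and
`blockForm` and `wedgeForm` are cocycles dual to these pairs. Hence the dimension is `n + n(n-1)/2`
for `su` and `n + (n+1)n/2` for `u`.

For `u(p,q)` and `su(p,q)` all parameters are products of two signs, so `n = 0`. The traceless parts
of affine matrices identify `iu(p,q)` with the special algebra whose parameters are `0` followed by
such signs, so `n = 1`. -/

noncomputable section

namespace UnitaryCK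

open scoped ComplexConjugate

/-! ### Cocycles, coboundaries and detection of the second cohomology -/

section Cohomology

/-- An alternating bilinear form on a real Lie algebra satisfying the cocycle identity. -/
structure IsCocycle {L : Type} [LieRing L] [LieAlgebra ℝ L] (c : L →ₗ[ℝ] L →ₗ[ℝ] ℝ) : Prop where
  alt : ∀ x, c x x = 0
  jac : ∀ x y z, c ⁅x, y⁆ z + c ⁅y, z⁆ x + c ⁅z, x⁆ y = 0

theorem IsCocycle.skew {L : Type} [LieRing L] [LieAlgebra ℝ L] {c : L →ₗ[ℝ] L →ₗ[ℝ] ℝ}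
    (hc : IsCocycle c) (x y : L) : c x y = -c y x := by
  have h := hc.alt (x + y)
  simp only [map_add, LinearMap.add_apply, hc.alt] at h
  linarith

/-- The coboundary of a linear form (up to sign). -/
def coboundary {L : Type} [LieRing L] [LieAlgebra ℝ L] (f : L →ₗ[ℝ] ℝ) : L →ₗ[ℝ] L →ₗ[ℝ] ℝ :=
  LinearMap.mk₂ ℝ (fun x y => f ⁅x, y⁆) (by simp) (by simp) (by simp) (by simp)

@[simp]
theorem coboundary_apply {L : Type} [LieRing L] [LieAlgebra ℝ L] (f : L →ₗ[ℝ] ℝ) (x y : L) :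
    coboundary f x y = f ⁅x, y⁆ := rfl

theorem IsCocycle.sub_coboundary {L : Type} [LieRing L] [LieAlgebra ℝ L]
    {c : L →ₗ[ℝ] L →ₗ[ℝ] ℝ} (hc : IsCocycle c) (f : L →ₗ[ℝ] ℝ) :
    IsCocycle (c - coboundary f) where
  alt x := by simp [hc.alt]
  jac x y z := by
    have h : ⁅⁅x, y⁆, z⁆ + ⁅⁅y, z⁆, x⁆ + ⁅⁅z, x⁆, y⁆ = 0 := by
      have := lie_jacobi x y z
      rw [← lie_skew x ⁅y, z⁆, ← lie_skew y ⁅z, x⁆, ← lie_skew z ⁅x, y⁆] at this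
      rw [← neg_eq_zero, ← this]
      abel
    have h' := congrArg f h
    simp only [map_add, map_zero] at h'
    simp only [LinearMap.sub_apply, coboundary_apply]
    linear_combination hc.jac x y z - h'

/-- The pairs `(x i, y i)` of commuting elements detect the second cohomology: a cocycle vanishing
on all of them is a coboundary, and there is a dual family of cocycles. -/
structure IsH2Basis (L : Type) [LieRing L] [LieAlgebra ℝ L] {ι : Type} (x y : ι → L) : Prop where
  comm : ∀ i, ⁅x i, y i⁆ = 0
  exact : ∀ c : L →ₗ[ℝ] L →ₗ[ℝ] ℝ, IsCocycle c → (∀ i, c (x i) (y i) = 0) →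
    ∃ f : L →ₗ[ℝ] ℝ, ∀ u v, c u v = f ⁅u, v⁆
  dual : ∀ i, ∃ c : L →ₗ[ℝ] L →ₗ[ℝ] ℝ, IsCocycle c ∧ c (x i) (y i) = 1 ∧
    ∀ j, j ≠ i → c (x j) (y j) = 0

variable {L : Type} [LieRing L] [LieAlgebra ℝ L]

theorem isCocycle_of_mem_twoCocycle
    (c : LieModule.Cohomology.twoCocycle ℝ L (TrivialLieModule ℝ L ℝ)) :
    IsCocycle (L := L) (c.1.1 : L →ₗ[ℝ] L →ₗ[ℝ] ℝ) where
  alt := c.1.2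
  jac x y z := by
    have h := (LieModule.Cohomology.mem_twoCocycle_iff_of_trivial ℝ L _ c.1).1 c.2 x y z
    have h1 := LieModule.Cohomology.twoCochain_skew c.1 ⁅y, z⁆ x
    change (c.1 ⁅x, y⁆ z : TrivialLieModule ℝ L ℝ) + c.1 ⁅y, z⁆ x + c.1 ⁅z, x⁆ y = 0
    rw [← lie_skew z x, map_neg]
    change (c.1 ⁅x, y⁆ z : TrivialLieModule ℝ L ℝ) + c.1 ⁅y, z⁆ x + -(c.1 ⁅x, z⁆ y) = 0
    have h3 := LieModule.Cohomology.twoCochain_skew c.1 ⁅x, z⁆ y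
    rw [h3, add_right_comm, ← h, ← h1, neg_add_cancel]

/-- A cocycle in the concrete sense, as an element of the space of 2-cocycles. -/
def IsCocycle.toTwoCocycle {c : L →ₗ[ℝ] L →ₗ[ℝ] ℝ} (hc : IsCocycle c) :
    LieModule.Cohomology.twoCocycle ℝ L (TrivialLieModule ℝ L ℝ) :=
  ⟨⟨c, hc.alt⟩, by
    rw [LieModule.Cohomology.mem_twoCocycle_iff_of_trivial]
    intro x y z
    change c x ⁅y, z⁆ = c ⁅x, y⁆ z + c y ⁅x, z⁆
    have h := hc.jac x y z
    rw [hc.skew x, hc.skew y, ← lie_skew x z, map_neg, LinearMap.neg_apply]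
    linarith⟩

/-- Evaluation on the pairs maps cocycles to `ι → ℝ`. Its kernel is the space of coboundaries, by
`comm` and `exact`, and it is onto by `dual`. -/
theorem IsH2Basis.rank_eq {ι : Type} [Fintype ι] {x y : ι → L} (h : IsH2Basis L x y) :
    Module.rank ℝ (H2 L) = (Fintype.card ι : Cardinal) := by
  classical
  let Φ : LieModule.Cohomology.twoCocycle ℝ L (TrivialLieModule ℝ L ℝ) →ₗ[ℝ] (ι → ℝ) :=
    { toFun := fun c i => (c.1.1 : L →ₗ[ℝ] L →ₗ[ℝ] ℝ) (x i) (y i)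
      map_add' := fun _ _ => rfl
      map_smul' := fun _ _ => rfl }
  have hker : (LinearMap.range (LieModule.Cohomology.d₁₂ ℝ L (TrivialLieModule ℝ L ℝ))).comap
      (LieModule.Cohomology.twoCocycle ℝ L (TrivialLieModule ℝ L ℝ)).subtype
      = LinearMap.ker Φ := by
    ext c
    rw [Submodule.mem_comap, LinearMap.mem_range, LinearMap.mem_ker]
    constructor
    · rintro ⟨f, hf⟩
      funext i
      have h1 := LieModule.Cohomology.d₁₂_apply_apply_ofTrivial ℝ L (TrivialLieModule ℝ L ℝ)
        f (x i) (y i)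
      rw [hf, h.comm i, map_zero, neg_zero] at h1
      exact h1
    · intro hc
      obtain ⟨f, hf⟩ := h.exact _ (isCocycle_of_mem_twoCocycle c) (fun i => congrFun hc i)
      -- For trivial coefficients `d₁₂ g` sends `(u, v)` to `-g ⁅u, v⁆`, hence the sign.
      let g : LieModule.Cohomology.oneCochain ℝ L (TrivialLieModule ℝ L ℝ) :=
        (-f : L →ₗ[ℝ] ℝ)
      refine ⟨g, ?_⟩
      apply Subtype.ext
      ext u v
      have h1 := LieModule.Cohomology.d₁₂_apply_apply_ofTrivial ℝ L (TrivialLieModule ℝ L ℝ) g u v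
      refine h1.trans ?_
      change -(-f ⁅u, v⁆) = _
      rw [neg_neg, ← hf]
      rfl
  have hsurj : Function.Surjective Φ := by
    rw [← LinearMap.range_eq_top, eq_top_iff, ← (Pi.basisFun ℝ ι).span_eq, Submodule.span_le]
    rintro _ ⟨i, rfl⟩
    obtain ⟨c, hc, h1, h0⟩ := h.dual i
    refine ⟨hc.toTwoCocycle, ?_⟩
    funext j
    change c (x j) (y j) = _
    by_cases hj : j = i
    · subst hj; simp [h1]
    · simp [h0 j hj, hj]
  have e := (Submodule.quotEquivOfEq _ _ hker).trans (Φ.quotKerEquivOfSurjective hsurj)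
  exact e.rank_eq.trans rank_fun'

theorem IsH2Basis.congr {L' : Type} [LieRing L'] [LieAlgebra ℝ L'] (e : L ≃ₗ⁅ℝ⁆ L') {ι : Type}
    {x y : ι → L} (h : IsH2Basis L x y) : IsH2Basis L' (e ∘ x) (e ∘ y) where
  comm i := by
    simp only [Function.comp_apply, ← LieEquiv.map_lie, h.comm, map_zero]
  exact c hc h0 := by
    obtain ⟨f, hf⟩ := h.exact (c.compl₁₂ (e : L →ₗ[ℝ] L') (e : L →ₗ[ℝ] L'))
      ⟨fun x => hc.alt _, fun x y z => by
        simpa [LieEquiv.map_lie] using hc.jac (e x) (e y) (e z)⟩ (fun i => h0 i)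
    refine ⟨f ∘ₗ (e.symm : L' →ₗ[ℝ] L), fun u v => ?_⟩
    have := hf (e.symm u) (e.symm v)
    simpa [LieEquiv.map_lie] using this
  dual i := by
    obtain ⟨c, hc, h1, h2⟩ := h.dual i
    refine ⟨c.compl₁₂ (e.symm : L' →ₗ[ℝ] L) (e.symm : L' →ₗ[ℝ] L),
      ⟨fun x => hc.alt _, fun x y z => by
        simpa [LieEquiv.map_lie] using hc.jac (e.symm x) (e.symm y) (e.symm z)⟩,
      by simpa using h1, fun j hj => by simpa using h2 j hj⟩

theorem isH2Basis_of_subsingleton [Subsingleton L] :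
    IsH2Basis L (Empty.elim : Empty → L) Empty.elim where
  comm i := i.elim
  exact c _ _ := ⟨0, fun u v => by simp [Subsingleton.elim u 0]⟩
  dual i := i.elim

end Cohomology

/-! ### Multiplicativity of the two-index coefficients -/

section Omega

variable {N : ℕ} (ω : Fin N → ℝ)

theorem omega_self (a : Fin (N + 1)) : omega ω a a = 1 :=
  Finset.prod_eq_one fun k _ => if_neg (by omega)

theorem omega_mul_omega {a b c : Fin (N + 1)} (hab : a ≤ b) (hbc : b ≤ c) :
    omega ω a b * omega ω b c = omega ω a c := by
  rw [omega, omega, omega, ← Finset.prod_mul_distrib]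
  refine Finset.prod_congr rfl fun k _ => ?_
  have h1 : (a : ℕ) ≤ b := hab
  have h2 : (b : ℕ) ≤ c := hbc
  by_cases h : (k : ℕ) < b
  · have : ¬ ((b : ℕ) ≤ k ∧ (k : ℕ) < c) := by omega
    rw [if_neg this, mul_one]
    congr 1
    rw [eq_iff_iff]
    omega
  · have : ¬ ((a : ℕ) ≤ k ∧ (k : ℕ) < b) := by omega
    rw [if_neg this, one_mul]
    congr 1
    rw [eq_iff_iff]
    omega

theorem omega_castSucc_succ (l : Fin N) : omega ω l.castSucc l.succ = ω l := by
  rw [omega, Finset.prod_eq_single l]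
  · simp
  · intro k _ hk
    refine if_neg fun h => hk (Fin.ext ?_)
    simp at h
    omega
  · simp

theorem omega_eq_zero {a b : Fin (N + 1)} {l : Fin N} (hl : ω l = 0) (ha : (a : ℕ) ≤ l)
    (hb : (l : ℕ) < b) : omega ω a b = 0 :=
  Finset.prod_eq_zero (Finset.mem_univ l) (by rw [if_pos ⟨ha, hb⟩, hl])

end Omega

/-! ### The concrete matrix algebra and its brackets -/

section Algebra

variable {N : ℕ} (ω : Fin N → ℝ) (μ : ℝ)

/-- The entrywise condition defining the Cayley--Klein algebras. -/
def IsSkew (X : Matrix (Fin (N + 1)) (Fin (N + 1)) ℂ) : Prop :=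
  ∀ a b, a ≤ b → X a b = -((omega ω a b : ℂ) * conj (X b a))

-- Multiplicativity of `ω` makes the formula independent of the position of `j`. If `j` lies outside
-- `[a, b]`, the surplus coefficient of one factor is what turns the other factor into its conjugate
-- transpose entry.
variable {ω} in
theorem IsSkew.mul_apply {X Y : Matrix (Fin (N + 1)) (Fin (N + 1)) ℂ} (hX : IsSkew ω X)
    (hY : IsSkew ω Y) {a b : Fin (N + 1)} (hab : a ≤ b) (j : Fin (N + 1)) :
    X a j * Y j b = (omega ω a b : ℂ) * (conj (X j a) * conj (Y b j)) := by
  rcases le_total a j with haj | hja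
  · rcases le_total j b with hjb | hbj
    · rw [hX a j haj, hY j b hjb, ← omega_mul_omega ω haj hjb]
      push_cast
      ring
    · rw [hX a j haj, hY b j hbj, ← omega_mul_omega ω hab hbj]
      simp only [map_neg, map_mul, Complex.conj_conj, Complex.conj_ofReal]
      push_cast
      ring
  · have hjb := hja.trans hab
    rw [hX j a hja, hY j b hjb, ← omega_mul_omega ω hja hab]
    simp only [map_neg, map_mul, Complex.conj_conj, Complex.conj_ofReal]
    push_cast
    ring

variable {ω} in
theorem IsSkew.lie {X Y : Matrix (Fin (N + 1)) (Fin (N + 1)) ℂ} (hX : IsSkew ω X)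
    (hY : IsSkew ω Y) : IsSkew ω ⁅X, Y⁆ := by
  intro a b hab
  rw [LieRing.of_associative_ring_bracket]
  simp only [Matrix.sub_apply, Matrix.mul_apply, map_sub, map_sum, map_mul]
  rw [Finset.sum_congr rfl fun j _ => hX.mul_apply hY hab j,
    Finset.sum_congr rfl fun j _ => hY.mul_apply hX hab j, ← Finset.mul_sum, ← Finset.mul_sum,
    ← mul_sub, ← mul_neg, neg_sub]
  simp only [mul_comm]

theorem sum_im_lie (X Y : Matrix (Fin (N + 1)) (Fin (N + 1)) ℂ) :
    ∑ a, (⁅X, Y⁆ a a).im = 0 := by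
  rw [← Complex.im_sum]
  change (Matrix.trace ⁅X, Y⁆).im = 0
  rw [LieRing.of_associative_ring_bracket, Matrix.trace_sub, Matrix.trace_mul_comm, sub_self,
    Complex.zero_im]

/-- The matrices satisfying the Cayley--Klein condition (`μ = 0`), or the traceless ones among
them (`μ ≠ 0`). -/
def ck : LieSubalgebra ℝ (Matrix (Fin (N + 1)) (Fin (N + 1)) ℂ) where
  carrier := {X | IsSkew ω X ∧ μ * ∑ a, (X a a).im = 0}
  zero_mem' := ⟨fun a b _ => by simp, by simp⟩
  add_mem' {X Y} hX hY := ⟨fun a b h => by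
      rw [Matrix.add_apply, Matrix.add_apply, hX.1 a b h, hY.1 a b h, map_add]
      ring,
    by simp [Finset.sum_add_distrib, mul_add, hX.2, hY.2]⟩
  smul_mem' c X hX := ⟨fun a b h => by
      simp only [Matrix.smul_apply, Complex.real_smul, map_mul, Complex.conj_ofReal]
      rw [hX.1 a b h]
      ring,
    by
      simp only [Matrix.smul_apply, Complex.real_smul, Complex.im_ofReal_mul, ← Finset.mul_sum]
      rw [mul_left_comm, hX.2, mul_zero]⟩
  lie_mem' {X Y} hX hY := ⟨hX.1.lie hY.1, by rw [sum_im_lie, mul_zero]⟩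

variable {ω μ} in
theorem mem_ck {X : Matrix (Fin (N + 1)) (Fin (N + 1)) ℂ} :
    X ∈ ck ω μ ↔ IsSkew ω X ∧ μ * ∑ a, (X a a).im = 0 := Iff.rfl

/-- The root vector `z e_{ba} - ω_{ab} z̄ e_{ab}`. -/
def rootMat (a b : Fin (N + 1)) : ℂ →ₗ[ℝ] Matrix (Fin (N + 1)) (Fin (N + 1)) ℂ where
  toFun z := Matrix.single b a z - Matrix.single a b ((omega ω a b : ℂ) * conj z)
  map_add' x y := by
    rw [map_add, mul_add, Matrix.single_add, Matrix.single_add]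
    abel
  map_smul' c x := by
    simp only [Complex.real_smul, map_mul, Complex.conj_ofReal, RingHom.id_apply, smul_sub,
      Matrix.smul_single]
    rw [mul_left_comm]

theorem rootMat_def (a b : Fin (N + 1)) (z : ℂ) : rootMat ω a b z =
    Matrix.single b a z - Matrix.single a b ((omega ω a b : ℂ) * conj z) := rfl

theorem rootMat_apply {a b : Fin (N + 1)} (hab : a < b) (z : ℂ) (i j : Fin (N + 1)) :
    rootMat ω a b z i j = if i = b ∧ j = a then z else
      if i = a ∧ j = b then -((omega ω a b : ℂ) * conj z) else 0 := by
  rw [rootMat_def, Matrix.sub_apply, Matrix.single_apply, Matrix.single_apply]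
  have := hab.ne
  grind

theorem rootMat_apply_self {a b : Fin (N + 1)} (hab : a < b) (z : ℂ) (i : Fin (N + 1)) :
    rootMat ω a b z i i = 0 := by
  rw [rootMat_apply ω hab, if_neg, if_neg]
  · rintro ⟨rfl, h⟩; exact hab.ne h
  · rintro ⟨rfl, h⟩; exact hab.ne' h

theorem isSkew_rootMat {a b : Fin (N + 1)} (hab : a < b) (z : ℂ) : IsSkew ω (rootMat ω a b z) := by
  intro i j hij
  rw [rootMat_apply ω hab, rootMat_apply ω hab]
  by_cases h : i = a ∧ j = b
  · obtain ⟨rfl, rfl⟩ := h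
    simp [hab.ne]
  · have h1 : ¬ (i = b ∧ j = a) := by
      rintro ⟨rfl, rfl⟩
      exact absurd hab (not_lt.2 hij)
    have h2 : ¬ (j = b ∧ i = a) := fun h' => h h'.symm
    have h3 : ¬ (j = a ∧ i = b) := fun h' => h1 h'.symm
    simp [h, h1, h2, h3]

/-- The diagonal matrix `i diag(t)`, shifted by a multiple of the identity. -/
def diagMat : (Fin (N + 1) → ℝ) →ₗ[ℝ] Matrix (Fin (N + 1)) (Fin (N + 1)) ℂ where
  toFun t := Matrix.diagonal fun a => ((t a - μ * ∑ c, t c : ℝ) : ℂ) * Complex.I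
  map_add' s t := by
    rw [Matrix.diagonal_add]
    congr 1
    funext a
    simp only [Pi.add_apply, Finset.sum_add_distrib]
    push_cast
    ring
  map_smul' c t := by
    rw [RingHom.id_apply, ← Matrix.diagonal_smul]
    congr 1
    funext a
    simp only [Pi.smul_apply, smul_eq_mul, ← Finset.mul_sum, Complex.real_smul]
    push_cast
    ring

theorem diagMat_def (t : Fin (N + 1) → ℝ) : diagMat μ t =
    Matrix.diagonal fun a => ((t a - μ * ∑ c, t c : ℝ) : ℂ) * Complex.I := rfl

theorem isSkew_diagMat (t : Fin (N + 1) → ℝ) : IsSkew ω (diagMat μ t) := by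
  intro i j _
  rw [diagMat_def]
  rcases eq_or_ne i j with rfl | h
  · rw [Matrix.diagonal_apply_eq, omega_self, map_mul, Complex.conj_I, Complex.conj_ofReal]
    push_cast
    ring
  · rw [Matrix.diagonal_apply_ne _ h, Matrix.diagonal_apply_ne _ h.symm]
    simp

theorem lie_diagMat_rootMat (t : Fin (N + 1) → ℝ) (a b : Fin (N + 1)) (z : ℂ) :
    ⁅diagMat μ t, rootMat ω a b z⁆ =
      rootMat ω a b (((t b - t a : ℝ) : ℂ) * Complex.I * z) := by
  have key : ∀ i j, (t i - μ * ∑ c, t c : ℝ) * Complex.I - (t j - μ * ∑ c, t c : ℝ) * Complex.I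
      = ((t i - t j : ℝ) : ℂ) * Complex.I := fun i j => by push_cast; ring
  have h : ∀ i j, ⁅diagMat μ t, rootMat ω a b z⁆ i j =
      ((t i - t j : ℝ) : ℂ) * Complex.I * rootMat ω a b z i j := by
    intro i j
    rw [LieRing.of_associative_ring_bracket, diagMat_def, Matrix.sub_apply, Matrix.diagonal_mul,
      Matrix.mul_diagonal, ← key]
    ring
  ext i j
  rw [h, rootMat_def, rootMat_def, Matrix.sub_apply, Matrix.sub_apply, mul_sub]
  congr 1
  · by_cases hij : b = i ∧ a = j
    · obtain ⟨rfl, rfl⟩ := hij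
      simp
    · simp [hij]
  · by_cases hij : a = i ∧ b = j
    · obtain ⟨rfl, rfl⟩ := hij
      simp only [Matrix.single_apply_same, map_mul, Complex.conj_I, Complex.conj_ofReal]
      push_cast
      ring
    · simp [hij]

theorem lie_diagMat_diagMat (s t : Fin (N + 1) → ℝ) : ⁅diagMat μ s, diagMat μ t⁆ = 0 := by
  rw [LieRing.of_associative_ring_bracket, diagMat_def, diagMat_def,
    Matrix.diagonal_mul_diagonal, Matrix.diagonal_mul_diagonal, sub_eq_zero]
  simp only [mul_comm]

theorem lie_rootMat_self {a b : Fin (N + 1)} (hab : a < b) (z w : ℂ) :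
    ⁅rootMat ω a b z, rootMat ω a b w⁆ = diagMat μ
      ((2 * omega ω a b * (conj z * w).im) • (Pi.single b 1 - Pi.single a 1)) := by
  have h := hab.ne
  have h' := hab.ne'
  rw [LieRing.of_associative_ring_bracket, rootMat_def, rootMat_def, diagMat_def]
  simp only [mul_sub, sub_mul, Matrix.single_mul_single_same]
  rw [Matrix.single_mul_single_of_ne _ _ _ _ h, Matrix.single_mul_single_of_ne _ _ _ _ h',
    Matrix.single_mul_single_of_ne _ _ _ _ h, Matrix.single_mul_single_of_ne _ _ _ _ h']
  ext i j
  have key (r : ℝ) : ((2 * omega ω a b * (conj z * w).im * r : ℝ) : ℂ) * Complex.I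
      = omega ω a b * (conj z * w - z * conj w) * r := by
    have h0 : 2 * (((conj z * w).im : ℝ) : ℂ) * Complex.I = conj z * w - z * conj w := by
      apply Complex.ext
      · simp
      · simp
        ring
    rw [← h0]
    push_cast
    ring
  rcases eq_or_ne i j with rfl | hij
  · simp only [Matrix.diagonal_apply_eq, Pi.smul_apply, Pi.sub_apply, smul_eq_mul,
      ← Finset.mul_sum, Finset.sum_sub_distrib, Finset.sum_pi_single', Finset.mem_univ, if_true,
      sub_self, mul_zero, sub_zero, zero_sub]
    rw [key]
    simp only [Matrix.sub_apply, Matrix.neg_apply, Matrix.single_apply, Pi.single_apply, and_self]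
    by_cases h1 : i = a
    · subst h1
      simp [h, h']
      ring
    · by_cases h2 : i = b
      · subst h2
        simp [h, h']
        ring
      · simp [h1, h2, Ne.symm h1, Ne.symm h2]
  · rw [Matrix.diagonal_apply_ne _ hij]
    simp only [Matrix.sub_apply, Matrix.single_apply, Matrix.zero_apply]
    grind

theorem single_mul_single_ite {n : Type} [Fintype n] [DecidableEq n] (i j k l : n) (x y : ℂ) :
    Matrix.single i j x * Matrix.single k l y =
      if j = k then Matrix.single i l (x * y) else 0 := by
  split_ifs with h
  · subst h
    exact Matrix.single_mul_single_same ..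
  · exact Matrix.single_mul_single_of_ne _ _ _ _ h _

theorem lie_rootMat_adjacent {a b c : Fin (N + 1)} (hab : a < b) (hbc : b < c) (x y : ℂ) :
    ⁅rootMat ω a b x, rootMat ω b c y⁆ = rootMat ω a c (-(x * y)) := by
  have hac := hab.trans hbc
  rw [LieRing.of_associative_ring_bracket, rootMat_def, rootMat_def, rootMat_def,
    ← omega_mul_omega ω hab.le hbc.le]
  simp only [mul_sub, sub_mul, single_mul_single_ite, hab.ne, hbc.ne, hac.ne, hab.ne', hbc.ne',
    hac.ne', if_true, if_false, map_neg, map_mul, mul_neg, ← Matrix.single_neg]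
  rw [show omega ω a b * conj x * (omega ω b c * conj y) =
    ((omega ω a b * omega ω b c : ℝ) : ℂ) * (conj x * conj y) by push_cast; ring, mul_comm y x]
  abel

theorem lie_rootMat_right {a b c : Fin (N + 1)} (hab : a < b) (hbc : b < c) (y z : ℂ) :
    ⁅rootMat ω b c y, rootMat ω a c z⁆ = rootMat ω a b (-(omega ω b c * (conj y * z))) := by
  have hac := hab.trans hbc
  rw [LieRing.of_associative_ring_bracket, rootMat_def, rootMat_def, rootMat_def,
    ← omega_mul_omega ω hab.le hbc.le]
  simp only [mul_sub, sub_mul, single_mul_single_ite, hab.ne, hbc.ne, hac.ne, hab.ne', hbc.ne',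
    hac.ne', if_true, if_false, map_neg, map_mul, mul_neg, ← Matrix.single_neg,
    Complex.conj_ofReal, Complex.conj_conj]
  rw [show omega ω a b * (omega ω b c * (y * conj z)) =
    ((omega ω a b * omega ω b c : ℝ) : ℂ) * conj z * y by push_cast; ring, mul_assoc]
  abel

theorem lie_rootMat_left {a b c : Fin (N + 1)} (hab : a < b) (hbc : b < c) (z x : ℂ) :
    ⁅rootMat ω a c z, rootMat ω a b x⁆ = rootMat ω b c (-(omega ω a b * (conj x * z))) := by
  have hac := hab.trans hbc
  rw [LieRing.of_associative_ring_bracket, rootMat_def, rootMat_def, rootMat_def,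
    ← omega_mul_omega ω hab.le hbc.le]
  simp only [mul_sub, sub_mul, single_mul_single_ite, hab.ne, hbc.ne, hac.ne, hab.ne', hbc.ne',
    hac.ne', if_true, if_false, map_neg, map_mul, mul_neg, ← Matrix.single_neg,
    Complex.conj_ofReal, Complex.conj_conj]
  rw [show omega ω b c * (omega ω a b * (x * conj z)) =
    x * (((omega ω a b * omega ω b c : ℝ) : ℂ) * conj z) by push_cast; ring,
    show z * (omega ω a b * conj x) = omega ω a b * (conj x * z) by ring]
  abel

theorem lie_rootMat_apply_self {a b c d : Fin (N + 1)} (hab : a < b) (hcd : c < d)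
    (h : ¬ (a = c ∧ b = d)) (z w : ℂ) (i : Fin (N + 1)) :
    ⁅rootMat ω a b z, rootMat ω c d w⁆ i i = 0 := by
  have h1 : ¬ (a = d ∧ b = c) := by
    rintro ⟨rfl, rfl⟩
    exact lt_asymm hab hcd
  rw [LieRing.of_associative_ring_bracket, rootMat_def, rootMat_def]
  simp only [mul_sub, sub_mul, single_mul_single_ite]
  simp only [Matrix.sub_apply, apply_ite (fun M : Matrix _ _ ℂ => M i i), Matrix.single_apply,
    Matrix.zero_apply]
  grind

end Algebra

/-! ### Simple coroots and the dual partial sums -/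

section SimpleCoroots

variable {N : ℕ}

/-- The vectors `e_a - e_{a+1}`, with the convention `e_{N+1} = 0`. -/
def coroot (a c : Fin (N + 1)) : ℝ :=
  (if c = a then 1 else 0) - if (c : ℕ) = a + 1 then 1 else 0

/-- The partial sums `t_0 + ⋯ + t_a`, dual to `coroot`. -/
def partialSum (a : Fin (N + 1)) : (Fin (N + 1) → ℝ) →ₗ[ℝ] ℝ where
  toFun t := ∑ c, if c ≤ a then t c else 0
  map_add' s t := by
    rw [← Finset.sum_add_distrib]
    exact Finset.sum_congr rfl fun c _ => by split_ifs <;> simp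
  map_smul' r t := by
    rw [RingHom.id_apply, smul_eq_mul, Finset.mul_sum]
    exact Finset.sum_congr rfl fun c _ => by split_ifs <;> simp

theorem partialSum_apply (a : Fin (N + 1)) (t : Fin (N + 1) → ℝ) :
    partialSum a t = ∑ c, if c ≤ a then t c else 0 := rfl

theorem partialSum_last (t : Fin (N + 1) → ℝ) : partialSum (Fin.last N) t = ∑ c, t c := by
  rw [partialSum_apply]
  exact Finset.sum_congr rfl fun c _ => if_pos (Fin.le_last c)

theorem partialSum_single (a b : Fin (N + 1)) :
    partialSum a (Pi.single b 1) = if b ≤ a then 1 else 0 := by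
  rw [partialSum_apply, Finset.sum_eq_single b]
  · simp
  · intro c _ hc
    simp [hc]
  · simp

theorem coroot_castSucc (l : Fin N) :
    coroot l.castSucc = Pi.single l.castSucc (1 : ℝ) - Pi.single l.succ 1 := by
  funext c
  rw [coroot, Pi.sub_apply, Pi.single_apply, Pi.single_apply]
  congr 2
  rw [eq_iff_iff, Fin.ext_iff]
  simp

theorem coroot_last : coroot (Fin.last N) = Pi.single (Fin.last N) (1 : ℝ) := by
  funext c
  have h : ¬ ((c : ℕ) = (Fin.last N : Fin (N + 1)) + 1) := by
    rw [Fin.val_last]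
    exact c.2.ne
  rw [coroot, Pi.single_apply, if_neg h, sub_zero]

theorem sum_coroot_castSucc (l : Fin N) : ∑ c, coroot l.castSucc c = 0 := by
  rw [coroot_castSucc]
  simp

theorem partialSum_coroot (a b : Fin (N + 1)) :
    partialSum a (coroot b) = if a = b then 1 else 0 := by
  induction b using Fin.lastCases with
  | last =>
    rw [coroot_last, partialSum_single]
    congr 1
    rw [eq_iff_iff, Fin.last_le_iff]
  | cast l =>
    rw [coroot_castSucc, map_sub, partialSum_single, partialSum_single]
    simp only [Fin.le_def, Fin.ext_iff, Fin.val_castSucc, Fin.val_succ]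
    split_ifs <;> first | omega | simp

/-- Abel summation: each coordinate is a difference of consecutive partial sums. -/
theorem eq_sum_coroot (t : Fin (N + 1) → ℝ) : t = ∑ a, partialSum a t • coroot a := by
  funext c
  simp only [Finset.sum_apply, Pi.smul_apply, coroot, smul_eq_mul, mul_sub,
    Finset.sum_sub_distrib, mul_ite, mul_one, mul_zero, Finset.sum_ite_eq, Finset.mem_univ, if_true]
  induction c using Fin.cases with
  | zero => simp [partialSum_apply]
  | succ k =>
    rw [Finset.sum_eq_single k.castSucc, if_pos (by simp), partialSum_apply, partialSum_apply,
      ← Finset.sum_sub_distrib, Finset.sum_eq_single k.succ]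
    · simp
    · intro b _ hb
      rw [Ne, Fin.ext_iff] at hb
      simp only [Fin.le_def, Fin.val_castSucc, Fin.val_succ] at hb ⊢
      split_ifs <;> first | omega | simp
    · simp
    · intro b _ hb
      rw [Ne, Fin.ext_iff] at hb
      refine if_neg fun h => hb ?_
      simp at h ⊢
      omega
    · simp

end SimpleCoroots

/-! ### Diagonal and root planes; identification of `su` and `u` -/

section Decomposition

variable {N : ℕ} (ω : Fin N → ℝ) (μ : ℝ)

/-- The pairs of indices `a < b`. -/
abbrev Pair (N : ℕ) : Type := {p : Fin (N + 1) × Fin (N + 1) // p.1 < p.2}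

/-- The imaginary parts of the diagonal entries. -/
def diagIm : Matrix (Fin (N + 1)) (Fin (N + 1)) ℂ →ₗ[ℝ] (Fin (N + 1) → ℝ) where
  toFun X a := (X a a).im
  map_add' X Y := by funext a; simp
  map_smul' c X := by funext a; simp

theorem diagIm_apply (X : Matrix (Fin (N + 1)) (Fin (N + 1)) ℂ) (a : Fin (N + 1)) :
    diagIm X a = (X a a).im := rfl

theorem diagIm_rootMat {a b : Fin (N + 1)} (hab : a < b) (z : ℂ) :
    diagIm (rootMat ω a b z) = 0 := by
  funext i
  rw [diagIm_apply, rootMat_apply_self ω hab]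
  rfl

theorem diagIm_diagMat (t : Fin (N + 1) → ℝ) :
    diagIm (diagMat μ t) = t - (μ * ∑ c, t c) • 1 := by
  funext i
  rw [diagIm_apply, diagMat_def, Matrix.diagonal_apply_eq, Complex.im_ofReal_mul]
  simp

theorem diagMat_apply_of_ne (t : Fin (N + 1) → ℝ) {i j : Fin (N + 1)} (h : i ≠ j) :
    diagMat μ t i j = 0 := by
  rw [diagMat_def, Matrix.diagonal_apply_ne _ h]

-- The entries below the diagonal determine those above it; the diagonal is purely imaginary because
-- `ω_{aa} = 1`, and the trace condition cancels the shift in `diagMat`.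
variable {ω μ} in
theorem eq_diagMat_add_sum {X : Matrix (Fin (N + 1)) (Fin (N + 1)) ℂ} (hX : X ∈ ck ω μ) :
    X = diagMat μ (diagIm X) + ∑ p : Pair N, rootMat ω p.1.1 p.1.2 (X p.1.2 p.1.1) := by
  obtain ⟨hs, ht⟩ := mem_ck.1 hX
  ext i j
  rw [Matrix.add_apply, Matrix.sum_apply]
  rcases lt_trichotomy i j with h | h | h
  · rw [diagMat_apply_of_ne _ _ h.ne, zero_add, Finset.sum_eq_single (⟨(i, j), h⟩ : Pair N),
      rootMat_apply ω h, if_neg fun h' => h.ne h'.1, if_pos ⟨rfl, rfl⟩, hs i j h.le]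
    · rintro ⟨⟨a, b⟩, hab⟩ _ hp
      have h1 : ¬ (i = a ∧ j = b) := by
        rintro ⟨rfl, rfl⟩
        exact hp rfl
      have h2 : ¬ (i = b ∧ j = a) := by
        rintro ⟨rfl, rfl⟩
        exact lt_asymm h hab
      rw [rootMat_apply ω hab, if_neg h2, if_neg h1]
    · simp
  · subst h
    rw [Finset.sum_eq_zero fun p _ => rootMat_apply_self ω p.2 _ i, add_zero, diagMat_def,
      Matrix.diagonal_apply_eq]
    simp only [diagIm_apply]
    rw [ht, sub_zero]
    have h1 := congrArg Complex.re (hs i i le_rfl)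
    rw [omega_self] at h1
    simp at h1
    apply Complex.ext
    · simp
      linarith
    · simp
  · rw [diagMat_apply_of_ne _ _ h.ne', zero_add, Finset.sum_eq_single (⟨(j, i), h⟩ : Pair N),
      rootMat_apply ω h, if_pos ⟨rfl, rfl⟩]
    · rintro ⟨⟨a, b⟩, hab⟩ _ hp
      have h1 : ¬ (i = b ∧ j = a) := by
        rintro ⟨rfl, rfl⟩
        exact hp rfl
      have h2 : ¬ (i = a ∧ j = b) := by
        rintro ⟨rfl, rfl⟩
        exact lt_asymm h hab
      rw [rootMat_apply ω hab, if_neg h1, if_neg h2]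
    · simp

theorem rootMat_mem_ck {a b : Fin (N + 1)} (hab : a < b) (z : ℂ) : rootMat ω a b z ∈ ck ω μ := by
  refine mem_ck.2 ⟨isSkew_rootMat ω hab z, ?_⟩
  simp [rootMat_apply_self ω hab]

-- By `hμ`, the map `t ↦ t - μ * ∑ t` is a projection onto the vectors with `μ * ∑ t = 0`: the
-- identity for `μ = 0`, removal of the mean for `μ = 1/(N+1)`.
variable {μ} in
theorem diagMat_mem_ck (hμ : μ * (1 - μ * (N + 1)) = 0) (t : Fin (N + 1) → ℝ) :
    diagMat μ t ∈ ck ω μ := by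
  refine mem_ck.2 ⟨isSkew_diagMat ω μ t, ?_⟩
  have : ∀ a, (diagMat μ t a a).im = t a - μ * ∑ c, t c := fun a => by
    rw [← diagIm_apply, diagIm_diagMat]
    simp
  simp only [this, Finset.sum_sub_distrib, Finset.sum_const, Finset.card_univ, Fintype.card_fin,
    nsmul_eq_mul]
  push_cast
  linear_combination (∑ c, t c) * hμ

theorem genJ_eq (a b : Fin (N + 1)) : genJ ω a b = rootMat ω a b 1 := by
  rw [genJ, rootMat_def, map_one, mul_one, neg_add_eq_sub]

theorem genM_eq (a b : Fin (N + 1)) : genM ω a b = rootMat ω a b Complex.I := by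
  rw [genM, rootMat_def, Complex.conj_I, mul_neg, ← Matrix.single_neg, sub_neg_eq_add, smul_add,
    Matrix.smul_single, Matrix.smul_single, add_comm (Matrix.single a b _), smul_eq_mul,
    smul_eq_mul, mul_one, mul_comm Complex.I]

theorem genB_eq (l : Fin N) : genB l = diagMat μ (coroot l.castSucc) := by
  rw [genB, diagMat_def, sum_coroot_castSucc, coroot_castSucc, mul_zero]
  have hl : l.castSucc ≠ l.succ := (Fin.castSucc_lt_succ (i := l)).ne
  ext i j
  rcases eq_or_ne i j with rfl | h
  · simp only [Matrix.smul_apply, Matrix.sub_apply, Matrix.single_apply, Matrix.diagonal_apply_eq,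
      sub_zero, Pi.sub_apply, Pi.single_apply, and_self, smul_eq_mul]
    by_cases h1 : i = l.castSucc
    · subst h1
      simp [hl, hl.symm]
    · by_cases h2 : i = l.succ
      · subst h2
        simp [hl, hl.symm]
      · simp [h1, h2, Ne.symm h1, Ne.symm h2]
  · rw [Matrix.diagonal_apply_ne _ h]
    have h1 : ¬ (l.castSucc = i ∧ l.castSucc = j) := fun h' => h (h'.1.symm.trans h'.2)
    have h2 : ¬ (l.succ = i ∧ l.succ = j) := fun h' => h (h'.1.symm.trans h'.2)
    simp [h1, h2]

theorem generators_subset_ck (hμ : μ * (1 - μ * (N + 1)) = 0) : generators ω ⊆ ck ω μ := by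
  rintro X (⟨a, b, hab, rfl | rfl⟩ | ⟨l, rfl⟩)
  · rw [genJ_eq]
    exact rootMat_mem_ck ω μ hab 1
  · rw [genM_eq]
    exact rootMat_mem_ck ω μ hab _
  · rw [genB_eq μ]
    exact diagMat_mem_ck ω hμ _

theorem rootMat_mem_su {a b : Fin (N + 1)} (hab : a < b) (z : ℂ) : rootMat ω a b z ∈ su ω := by
  have hz : z = z.re • (1 : ℂ) + z.im • Complex.I := by
    apply Complex.ext <;> simp
  rw [hz, map_add, map_smul, map_smul, ← genJ_eq, ← genM_eq]
  refine add_mem ((su ω).smul_mem _ ?_) ((su ω).smul_mem _ ?_)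
  · exact LieSubalgebra.subset_lieSpan (Or.inl ⟨a, b, hab, Or.inl rfl⟩)
  · exact LieSubalgebra.subset_lieSpan (Or.inl ⟨a, b, hab, Or.inr rfl⟩)

theorem diagMat_mem_su {t : Fin (N + 1) → ℝ} (ht : ∑ c, t c = 0) : diagMat μ t ∈ su ω := by
  rw [eq_sum_coroot t, map_sum]
  refine sum_mem fun a _ => ?_
  rw [map_smul]
  induction a using Fin.lastCases with
  | last =>
    rw [partialSum_last, ht, zero_smul]
    exact zero_mem _
  | cast l =>
    rw [← genB_eq]
    exact (su ω).smul_mem _ (LieSubalgebra.subset_lieSpan (Or.inr ⟨l, rfl⟩))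

theorem inv_mul_self_eq_zero :
    ((N + 1 : ℝ)⁻¹) * (1 - (N + 1 : ℝ)⁻¹ * (N + 1)) = 0 := by
  rw [inv_mul_cancel₀ (by positivity), sub_self, mul_zero]

/-- The generators already span `ck` linearly, so no bracket has to be formed for the inclusion of
`ck` in the generated algebra. -/
theorem su_eq_ck : su ω = ck ω (N + 1 : ℝ)⁻¹ := by
  refine le_antisymm
    (LieSubalgebra.lieSpan_le.2 (generators_subset_ck ω _ inv_mul_self_eq_zero)) fun X hX => ?_
  rw [eq_diagMat_add_sum hX]
  refine add_mem (diagMat_mem_su ω _ ?_) (sum_mem fun p _ => rootMat_mem_su ω p.2 _)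
  exact (mul_eq_zero.1 (mem_ck.1 hX).2).resolve_left (by positivity)

theorem I_smul_one_eq : Complex.I • (1 : Matrix (Fin (N + 1)) (Fin (N + 1)) ℂ) = diagMat 0 1 := by
  rw [diagMat_def, Matrix.smul_one_eq_diagonal]
  simp

theorem u_eq_ck : u ω = ck ω 0 := by
  refine le_antisymm (LieSubalgebra.lieSpan_le.2 (Set.insert_subset ?_
    (generators_subset_ck ω _ (by simp)))) fun X hX => ?_
  · rw [I_smul_one_eq]
    exact diagMat_mem_ck ω (by simp) _
  have hle : su ω ≤ u ω := LieSubalgebra.lieSpan_mono (Set.subset_insert _ _)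
  rw [eq_diagMat_add_sum hX]
  refine add_mem ?_ (sum_mem fun p _ => hle (rootMat_mem_su ω p.2 _))
  set t := diagIm X
  -- Removing the mean leaves a sum-zero vector, which is in `su`; the mean itself is covered by the
  -- extra generator `i • 1`.
  have ht : t = (t - ((N + 1 : ℝ)⁻¹ * ∑ c, t c) • 1) + ((N + 1 : ℝ)⁻¹ * ∑ c, t c) • 1 := by
    rw [sub_add_cancel]
  rw [ht, map_add, map_smul, ← I_smul_one_eq]
  refine add_mem (hle (diagMat_mem_su ω 0 ?_)) ((u ω).smul_mem _
    (LieSubalgebra.subset_lieSpan (Set.mem_insert _ _)))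
  have : (N + 1 : ℝ) ≠ 0 := by positivity
  simp
  field_simp
  ring

end Decomposition

/-! ### Normalizing a cocycle with a regular diagonal element -/

section Normalization

variable {N : ℕ} (ω : Fin N → ℝ) {μ : ℝ} (hμ : μ * (1 - μ * (N + 1)) = 0)

/-- The root vectors as elements of the Cayley--Klein algebra. -/
def rootVec (μ : ℝ) (p : Pair N) : ℂ →ₗ[ℝ] ck ω μ where
  toFun z := ⟨rootMat ω p.1.1 p.1.2 z, rootMat_mem_ck ω μ p.2 z⟩
  map_add' x y := Subtype.ext (map_add _ x y)
  map_smul' c x := Subtype.ext (map_smul _ c x)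

/-- The diagonal elements of the Cayley--Klein algebra. -/
def cartan : (Fin (N + 1) → ℝ) →ₗ[ℝ] ck ω μ where
  toFun t := ⟨diagMat μ t, diagMat_mem_ck ω hμ t⟩
  map_add' x y := Subtype.ext (map_add _ x y)
  map_smul' c x := Subtype.ext (map_smul _ c x)

theorem coe_rootVec (p : Pair N) (z : ℂ) :
    (rootVec ω μ p z : Matrix (Fin (N + 1)) (Fin (N + 1)) ℂ) = rootMat ω p.1.1 p.1.2 z := rfl

theorem coe_cartan (t : Fin (N + 1) → ℝ) :
    (cartan ω hμ t : Matrix (Fin (N + 1)) (Fin (N + 1)) ℂ) = diagMat μ t := rfl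

theorem lie_cartan_rootVec (t : Fin (N + 1) → ℝ) (p : Pair N) (z : ℂ) :
    ⁅cartan ω hμ t, rootVec ω μ p z⁆ =
      rootVec ω μ p (((t p.1.2 - t p.1.1 : ℝ) : ℂ) * Complex.I * z) :=
  Subtype.ext (lie_diagMat_rootMat ω μ t _ _ z)

theorem lie_cartan_cartan (s t : Fin (N + 1) → ℝ) : ⁅cartan ω hμ s, cartan ω hμ t⁆ = 0 :=
  Subtype.ext (lie_diagMat_diagMat μ s t)

theorem lie_rootVec_self (p : Pair N) (z w : ℂ) :
    ⁅rootVec ω μ p z, rootVec ω μ p w⁆ = cartan ω hμ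
      ((2 * omega ω p.1.1 p.1.2 * (conj z * w).im) • (Pi.single p.1.2 1 - Pi.single p.1.1 1)) :=
  Subtype.ext (lie_rootMat_self ω μ p.2 z w)

theorem diagIm_lie_rootVec {p q : Pair N} (h : p ≠ q) (z w : ℂ) :
    diagIm (⁅rootVec ω μ p z, rootVec ω μ q w⁆ : ck ω μ).1 = 0 := by
  funext i
  rw [diagIm_apply]
  change (⁅rootMat ω p.1.1 p.1.2 z, rootMat ω q.1.1 q.1.2 w⁆ i i).im = 0
  rw [lie_rootMat_apply_self ω p.2 q.2]
  · rfl
  · rintro ⟨h1, h2⟩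
    exact h (Subtype.ext (Prod.ext h1 h2))

theorem eq_cartan_add_sum (X : ck ω μ) :
    X = cartan ω hμ (diagIm X.1) + ∑ p : Pair N, rootVec ω μ p (X.1 p.1.2 p.1.1) := by
  apply Subtype.ext
  have h := eq_diagMat_add_sum X.2
  have h1 : ((∑ p : Pair N, rootVec ω μ p (X.1 p.1.2 p.1.1) : ck ω μ) :
      Matrix (Fin (N + 1)) (Fin (N + 1)) ℂ) =
      ∑ p : Pair N, rootMat ω p.1.1 p.1.2 (X.1 p.1.2 p.1.1) :=
    map_sum (ck ω μ).toSubmodule.subtype _ _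
  change X.1 = diagMat μ (diagIm X.1) + _
  rw [h1]
  exact h

include hμ in
theorem eq_zero_of_cartan_of_rootVec {f : ck ω μ →ₗ[ℝ] ℝ} (hD : ∀ t, f (cartan ω hμ t) = 0)
    (hE : ∀ p z, f (rootVec ω μ p z) = 0) (X : ck ω μ) : f X = 0 := by
  rw [eq_cartan_add_sum ω hμ X, map_add, map_sum, hD, Finset.sum_eq_zero fun p _ => hE p _,
    add_zero]

include hμ in
theorem eq_zero_of_rootVec {f : ck ω μ →ₗ[ℝ] ℝ} (hE : ∀ p z, f (rootVec ω μ p z) = 0)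
    (X : ck ω μ) (hX : diagIm X.1 = 0) : f X = 0 := by
  rw [eq_cartan_add_sum ω hμ X, map_add, map_sum, hX, map_zero, map_zero,
    Finset.sum_eq_zero fun p _ => hE p _, add_zero]

/-- The linear form with prescribed values on the root vectors, vanishing on the diagonal. -/
def rootForm (g : Pair N → ℂ →ₗ[ℝ] ℝ) : ck ω μ →ₗ[ℝ] ℝ where
  toFun X := ∑ p : Pair N, g p (X.1 p.1.2 p.1.1)
  map_add' X Y := by
    rw [← Finset.sum_add_distrib]
    exact Finset.sum_congr rfl fun p _ => map_add _ _ _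
  map_smul' c X := by
    rw [RingHom.id_apply, Finset.smul_sum]
    exact Finset.sum_congr rfl fun p _ => (g p).map_smul c (X.1 p.1.2 p.1.1)

theorem rootForm_rootVec (g : Pair N → ℂ →ₗ[ℝ] ℝ) (p : Pair N) (z : ℂ) :
    rootForm ω g (rootVec ω μ p z) = g p z := by
  change ∑ q : Pair N, g q (rootMat ω p.1.1 p.1.2 z q.1.2 q.1.1) = _
  rw [Finset.sum_eq_single p]
  · rw [rootMat_apply ω p.2, if_pos ⟨rfl, rfl⟩]
  · intro q _ hq
    rw [rootMat_apply ω p.2, if_neg, if_neg, map_zero]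
    · rintro ⟨h1, h2⟩
      have h3 := q.2
      rw [h1, h2] at h3
      exact lt_asymm p.2 h3
    · rintro ⟨h1, h2⟩
      exact hq (Subtype.ext (Prod.ext h2 h1))
  · simp

/-- A diagonal element on which all roots take distinct positive values. -/
def regularElement (a : Fin (N + 1)) : ℝ := 2 ^ (a : ℕ)

theorem regularElement_pos (p : Pair N) :
    0 < regularElement p.1.2 - regularElement p.1.1 :=
  sub_pos.2 (pow_lt_pow_right₀ one_lt_two p.2)

/-- The value `2 ^ b - 2 ^ a` with `a < b` lies in `[2 ^ (b-1), 2 ^ b)`, and these intervals are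
disjoint for different `b`. -/
theorem regularElement_sub_lt {p q : Pair N} (h : p.1.2 < q.1.2) :
    regularElement p.1.2 - regularElement p.1.1 < regularElement q.1.2 - regularElement q.1.1 := by
  have h1 : (2 : ℝ) ^ (p.1.2 : ℕ) ≤ 2 ^ ((q.1.2 : ℕ) - 1) :=
    pow_le_pow_right₀ one_le_two (Nat.le_sub_one_of_lt h)
  have h2 : (2 : ℝ) ^ (q.1.1 : ℕ) ≤ 2 ^ ((q.1.2 : ℕ) - 1) :=
    pow_le_pow_right₀ one_le_two (Nat.le_sub_one_of_lt q.2)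
  have h3 : (2 : ℝ) ^ (q.1.2 : ℕ) = 2 * 2 ^ ((q.1.2 : ℕ) - 1) := by
    rw [← pow_succ']
    congr 1
    have : (p.1.2 : ℕ) < q.1.2 := h
    omega
  have h4 : (0 : ℝ) < 2 ^ (p.1.1 : ℕ) := by positivity
  simp only [regularElement]
  linarith

theorem regularElement_injective {p q : Pair N}
    (h : regularElement p.1.2 - regularElement p.1.1 =
      regularElement q.1.2 - regularElement q.1.1) : p = q := by
  have h2 : p.1.2 = q.1.2 := by
    rcases lt_trichotomy p.1.2 q.1.2 with h' | h' | h'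
    · exact absurd h (regularElement_sub_lt h').ne
    · exact h'
    · exact absurd h (regularElement_sub_lt h').ne'
  rw [h2, sub_right_inj] at h
  exact Subtype.ext (Prod.ext (Fin.ext
    (pow_right_injective₀ (zero_lt_two' ℝ) (by norm_num) h)) h2)

/-- A bilinear form on the Cayley--Klein algebra for which the root planes are orthogonal to each
other and to the diagonal elements. -/
structure IsNormal (c : ck ω μ →ₗ[ℝ] ck ω μ →ₗ[ℝ] ℝ) : Prop where
  cartan_root : ∀ s p z, c (cartan ω hμ s) (rootVec ω μ p z) = 0
  root_root : ∀ p q, p ≠ q → ∀ z w, c (rootVec ω μ p z) (rootVec ω μ q w) = 0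

variable {ω hμ} {c : ck ω μ →ₗ[ℝ] ck ω μ →ₗ[ℝ] ℝ}

/-- Once the regular element `h` is orthogonal to the root planes, the cocycle identity says that
`ad h` preserves `c` wherever the remaining bracket has no diagonal part. Invertibility of `ad h` on
each plane handles the diagonal; distinctness of the speeds separates the planes. -/
theorem IsCocycle.isNormal (hc : IsCocycle c)
    (h0 : ∀ p z, c (cartan ω hμ regularElement) (rootVec ω μ p z) = 0) : IsNormal ω hμ c where
  cartan_root s p z := by
    have hα := (regularElement_pos p).ne'
    set α := regularElement p.1.2 - regularElement p.1.1 with hα'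
    -- The third argument is the preimage of `rootVec ω μ p z` under the bracket with the regular
    -- element.
    have h := hc.jac (cartan ω hμ regularElement) (cartan ω hμ s)
      (rootVec ω μ p (-((α⁻¹ : ℝ) : ℂ) * Complex.I * z))
    rw [lie_cartan_cartan, lie_cartan_rootVec, ← lie_skew, lie_cartan_rootVec, ← hα',
      hc.skew _ (cartan ω hμ regularElement), h0, map_zero, LinearMap.zero_apply, map_neg,
      LinearMap.neg_apply, ← hc.skew] at h
    have h1 : (α : ℂ) * Complex.I * (-((α⁻¹ : ℝ) : ℂ) * Complex.I * z) = z := by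
      have : (α : ℂ) * ((α⁻¹ : ℝ) : ℂ) = 1 := by
        rw [← Complex.ofReal_mul, mul_inv_cancel₀ hα, Complex.ofReal_one]
      linear_combination (-Complex.I ^ 2 * z) * this - z * Complex.I_sq
    rw [h1] at h
    simpa using h
  root_root p q hpq z w := by
    have hne : (regularElement p.1.2 - regularElement p.1.1) ≠
        (regularElement q.1.2 - regularElement q.1.1) := fun h => hpq (regularElement_injective h)
    have hα := regularElement_pos p
    have hβ := regularElement_pos q
    set α := regularElement p.1.2 - regularElement p.1.1 with hα'
    set β := regularElement q.1.2 - regularElement q.1.1 with hβ'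
    have key : ∀ z w, α * c (rootVec ω μ p (Complex.I * z)) (rootVec ω μ q w) +
        β * c (rootVec ω μ p z) (rootVec ω μ q (Complex.I * w)) = 0 := by
      intro z w
      have h := hc.jac (cartan ω hμ regularElement) (rootVec ω μ p z) (rootVec ω μ q w)
      -- The bracket of two different planes has no diagonal part, so it is a sum of root vectors
      -- and `h0` applies to it.
      rw [hc.skew ⁅rootVec ω μ p z, rootVec ω μ q w⁆,
        eq_zero_of_rootVec ω hμ h0 _ (diagIm_lie_rootVec ω hpq z w), ← lie_skew (rootVec ω μ q w),
        lie_cartan_rootVec, lie_cartan_rootVec, ← hα', ← hβ', map_neg, LinearMap.neg_apply,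
        ← hc.skew, mul_assoc, mul_assoc, ← Complex.real_smul, ← Complex.real_smul, map_smul,
        map_smul, map_smul, map_smul, LinearMap.smul_apply, smul_eq_mul, smul_eq_mul] at h
      linarith
    have e1 := key (Complex.I * z) w
    have e2 := key z (Complex.I * w)
    rw [← mul_assoc, Complex.I_mul_I, neg_one_mul, map_neg, map_neg] at e1 e2
    rw [LinearMap.neg_apply] at e1
    set A := c (rootVec ω μ p z) (rootVec ω μ q w)
    set B := c (rootVec ω μ p (Complex.I * z)) (rootVec ω μ q (Complex.I * w))
    -- Eliminating `B` from `-α A + β B = 0` and `α B - β A = 0` gives `(α² - β²) A = 0`.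
    have e3 : (α - β) * ((α + β) * A) = 0 := by linear_combination -α * e1 + β * e2
    exact (mul_eq_zero.1 ((mul_eq_zero.1 e3).resolve_left (sub_ne_zero.2 hne))).resolve_left
      (by positivity)

-- With `h` the regular element, `f` is defined on each root plane by `f ⁅h, v⁆ = c h v`, which is
-- possible because `ad h` is invertible there.
variable (hμ) in
theorem IsCocycle.exists_isNormal (hc : IsCocycle c) :
    ∃ f : ck ω μ →ₗ[ℝ] ℝ, IsNormal ω hμ (c - coboundary f) := by
  let g : Pair N → ℂ →ₗ[ℝ] ℝ := fun p =>
    (c (cartan ω hμ regularElement)) ∘ₗ rootVec ω μ p ∘ₗ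
      LinearMap.mulLeft ℝ
        (-(((regularElement p.1.2 - regularElement p.1.1)⁻¹ : ℝ) : ℂ) * Complex.I)
  refine ⟨rootForm ω g, (hc.sub_coboundary _).isNormal fun p z => ?_⟩
  rw [LinearMap.sub_apply, LinearMap.sub_apply, coboundary_apply, lie_cartan_rootVec,
    rootForm_rootVec]
  change _ - c (cartan ω hμ regularElement) (rootVec ω μ p (_ * (_ * _ * z))) = 0
  rw [sub_eq_zero]
  congr 2
  have : ((regularElement p.1.2 - regularElement p.1.1 : ℝ) : ℂ) *
      (((regularElement p.1.2 - regularElement p.1.1)⁻¹ : ℝ) : ℂ) = 1 := by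
    rw [← Complex.ofReal_mul, mul_inv_cancel₀ (regularElement_pos p).ne', Complex.ofReal_one]
  linear_combination (Complex.I ^ 2 * z) * this + z * Complex.I_sq

end Normalization

/-! ### What remains of a normalized cocycle, and exactness -/

section NormalCocycles

variable {N : ℕ} {ω : Fin N → ℝ} {μ : ℝ} {hμ : μ * (1 - μ * (N + 1)) = 0}
  {c : ck ω μ →ₗ[ℝ] ck ω μ →ₗ[ℝ] ℝ}

/-- The value of a bilinear form on the standard basis of a root plane. -/
def planeValue (c : ck ω μ →ₗ[ℝ] ck ω μ →ₗ[ℝ] ℝ) (p : Pair N) : ℝ :=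
  c (rootVec ω μ p 1) (rootVec ω μ p Complex.I)

/-- An alternating form on a real plane is a multiple of the area form. -/
theorem IsCocycle.rootVec_rootVec (hc : IsCocycle c) (p : Pair N) (z w : ℂ) :
    c (rootVec ω μ p z) (rootVec ω μ p w) = planeValue c p * (conj z * w).im := by
  have h (z : ℂ) : z = z.re • (1 : ℂ) + z.im • Complex.I := by
    apply Complex.ext <;> simp
  have hz : rootVec ω μ p z =
      z.re • rootVec ω μ p 1 + z.im • rootVec ω μ p Complex.I := by
    rw [← map_smul, ← map_smul, ← map_add, ← h]
  have hw : rootVec ω μ p w =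
      w.re • rootVec ω μ p 1 + w.im • rootVec ω μ p Complex.I := by
    rw [← map_smul, ← map_smul, ← map_add, ← h]
  rw [hz, hw]
  simp only [map_add, map_smul, LinearMap.add_apply, LinearMap.smul_apply, hc.alt, smul_eq_mul]
  rw [hc.skew (rootVec ω μ p Complex.I), planeValue, Complex.mul_im, Complex.conj_re,
    Complex.conj_im]
  ring

/-- In the cocycle identity for `s` and the basis `1`, `I` of the simple plane, `s` sends each basis
vector to a multiple of the other, so two terms vanish by alternation. The third is the value at `s`
and `-2 ω_l` times the coroot. -/
theorem IsCocycle.cartan_coroot (hc : IsCocycle c) (s : Fin (N + 1) → ℝ) (l : Fin N)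
    (hl : ω l ≠ 0) : c (cartan ω hμ s) (cartan ω hμ (coroot l.castSucc)) = 0 := by
  let p : Pair N := ⟨(l.castSucc, l.succ), Fin.castSucc_lt_succ⟩
  have h := hc.jac (cartan ω hμ s) (rootVec ω μ p 1) (rootVec ω μ p Complex.I)
  rw [lie_cartan_rootVec, lie_rootVec_self ω hμ, ← lie_skew (rootVec ω μ p Complex.I),
    lie_cartan_rootVec, map_neg, LinearMap.neg_apply, hc.rootVec_rootVec, hc.rootVec_rootVec,
    map_smul, map_smul, LinearMap.smul_apply, hc.skew _ (cartan ω hμ s)] at h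
  have e : (Pi.single p.1.2 1 - Pi.single p.1.1 1 : Fin (N + 1) → ℝ) = -coroot l.castSucc := by
    rw [coroot_castSucc, neg_sub]
  have e' : omega ω p.1.1 p.1.2 = ω l := omega_castSucc_succ ω l
  rw [e, e', map_neg, map_neg] at h
  simp at h
  exact h.resolve_left hl

/-- The planes `ij`, `jk`, `ik` bracket cyclically into one another, so the cocycle identity on one
vector from each is a linear relation among the three area factors. -/
theorem IsCocycle.planeValue_add (hc : IsCocycle c) {i j k : Fin (N + 1)} (hij : i < j)
    (hjk : j < k) : planeValue c ⟨(i, k), hij.trans hjk⟩ =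
      omega ω j k * planeValue c ⟨(i, j), hij⟩ + omega ω i j * planeValue c ⟨(j, k), hjk⟩ := by
  let p : Pair N := ⟨(i, j), hij⟩
  let q : Pair N := ⟨(j, k), hjk⟩
  let r : Pair N := ⟨(i, k), hij.trans hjk⟩
  have h := hc.jac (rootVec ω μ p 1) (rootVec ω μ q 1) (rootVec ω μ r Complex.I)
  have h1 : ⁅rootVec ω μ p 1, rootVec ω μ q 1⁆ = rootVec ω μ r (-(1 * 1)) :=
    Subtype.ext (lie_rootMat_adjacent ω hij hjk 1 1)
  have h2 : ⁅rootVec ω μ q 1, rootVec ω μ r Complex.I⁆ =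
      rootVec ω μ p (-(omega ω j k * (conj 1 * Complex.I))) :=
    Subtype.ext (lie_rootMat_right ω hij hjk 1 Complex.I)
  have h3 : ⁅rootVec ω μ r Complex.I, rootVec ω μ p 1⁆ =
      rootVec ω μ q (-(omega ω i j * (conj 1 * Complex.I))) :=
    Subtype.ext (lie_rootMat_left ω hij hjk Complex.I 1)
  rw [h1, h2, h3, hc.rootVec_rootVec, hc.rootVec_rootVec, hc.rootVec_rootVec] at h
  simp at h
  linarith

theorem cartan_eq (t : Fin (N + 1) → ℝ) :
    cartan ω hμ t = cartan ω hμ (t - (μ * ∑ c, t c) • 1) := by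
  refine Subtype.ext ?_
  rw [coe_cartan, coe_cartan, diagMat_def, diagMat_def]
  congr 1
  funext a
  congr 2
  simp only [Pi.sub_apply, Pi.smul_apply, Pi.one_apply, smul_eq_mul, mul_one,
    Finset.sum_sub_distrib, Finset.sum_const, Finset.card_univ, Fintype.card_fin, nsmul_eq_mul]
  push_cast
  linear_combination (∑ c, t c) * hμ

/-- The coroots form a basis of the diagonal vectors. If `μ ≠ 0`, the projected vector has sum zero,
so the last coroot has coefficient zero and needs no hypothesis. -/
theorem eq_zero_of_coroot {f : ck ω μ →ₗ[ℝ] ℝ}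
    (h : ∀ l : Fin N, f (cartan ω hμ (coroot l.castSucc)) = 0)
    (hlast : μ = 0 → f (cartan ω hμ (coroot (Fin.last N))) = 0) (t : Fin (N + 1) → ℝ) :
    f (cartan ω hμ t) = 0 := by
  rw [cartan_eq]
  set t' := t - (μ * ∑ c, t c) • 1 with ht'
  have hsum : μ * ∑ c, t' c = 0 := by
    simp only [ht', Pi.sub_apply, Pi.smul_apply, Pi.one_apply, smul_eq_mul, mul_one,
      Finset.sum_sub_distrib, Finset.sum_const, Finset.card_univ, Fintype.card_fin, nsmul_eq_mul]
    push_cast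
    linear_combination (∑ c, t c) * hμ
  rw [eq_sum_coroot t', map_sum, map_sum]
  refine Finset.sum_eq_zero fun a _ => ?_
  rw [map_smul, map_smul]
  induction a using Fin.lastCases with
  | last =>
    rw [partialSum_last]
    rcases mul_eq_zero.1 hsum with h0 | h0
    · rw [hlast h0, smul_zero]
    · rw [h0, zero_smul]
  | cast l => rw [h, smul_zero]

theorem diagIm_cartan_coroot (hμ : μ * (1 - μ * (N + 1)) = 0) (l : Fin N) :
    diagIm (cartan ω hμ (coroot l.castSucc)).1 = coroot l.castSucc := by
  rw [coe_cartan, diagIm_diagMat, sum_coroot_castSucc, mul_zero, zero_smul, sub_zero]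

theorem IsNormal.eq_zero (hn : IsNormal ω hμ c) (hc : IsCocycle c)
    (hE : ∀ p, planeValue c p = 0)
    (hD : ∀ s t, c (cartan ω hμ s) (cartan ω hμ t) = 0) (X Y : ck ω μ) : c X Y = 0 := by
  have h1 : ∀ s Y, c (cartan ω hμ s) Y = 0 := fun s =>
    eq_zero_of_cartan_of_rootVec ω hμ (hD s) (hn.cartan_root s)
  refine eq_zero_of_cartan_of_rootVec ω hμ (f := c X) (fun t => ?_) (fun p z => ?_) Y
  · rw [hc.skew, h1, neg_zero]
  · rw [hc.skew, neg_eq_zero]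
    refine eq_zero_of_cartan_of_rootVec ω hμ (f := c (rootVec ω μ p z)) (fun t => ?_)
      (fun q w => ?_) X
    · rw [hc.skew, h1, neg_zero]
    · rcases eq_or_ne p q with rfl | hpq
      · rw [hc.rootVec_rootVec, hE, zero_mul]
      · exact hn.root_root p q hpq z w

theorem IsCocycle.planeValue_eq_zero (hc : IsCocycle c)
    (h : ∀ l : Fin N, planeValue c ⟨(l.castSucc, l.succ), Fin.castSucc_lt_succ⟩ = 0)
    (p : Pair N) : planeValue c p = 0 := by
  obtain ⟨⟨a, b⟩, hab⟩ := p
  induction b using Fin.induction with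
  | zero => exact absurd hab (Fin.not_lt_zero a)
  | succ l ih =>
    rcases eq_or_lt_of_le (Fin.le_castSucc_iff.2 hab) with rfl | hlt
    · exact h l
    · rw [hc.planeValue_add hlt Fin.castSucc_lt_succ, ih hlt, h l, mul_zero, mul_zero, add_zero]

theorem IsCocycle.cartan_cartan (hc : IsCocycle c)
    (h : ∀ a b : Fin (N + 1), a < b → (Fin.snoc ω μ : Fin (N + 1) → ℝ) a = 0 →
      (Fin.snoc ω μ : Fin (N + 1) → ℝ) b = 0 →
      c (cartan ω hμ (coroot a)) (cartan ω hμ (coroot b)) = 0) (s t : Fin (N + 1) → ℝ) :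
    c (cartan ω hμ s) (cartan ω hμ t) = 0 := by
  -- The side conditions discard the last coroot when `μ ≠ 0`. A remaining coroot with nonzero
  -- parameter is some `coroot l.castSucc` with `ω l ≠ 0`, orthogonal to the whole diagonal.
  have key : ∀ a b, (a = Fin.last N → μ = 0) → (b = Fin.last N → μ = 0) →
      c (cartan ω hμ (coroot a)) (cartan ω hμ (coroot b)) = 0 := by
    have aux : ∀ a s, (a = Fin.last N → μ = 0) → (Fin.snoc ω μ : Fin (N + 1) → ℝ) a ≠ 0 →
        c (cartan ω hμ s) (cartan ω hμ (coroot a)) = 0 := by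
      intro a s ha h0
      induction a using Fin.lastCases with
      | last => exact absurd (ha rfl) (by simpa using h0)
      | cast l => exact hc.cartan_coroot s l (by simpa using h0)
    intro a b ha hb
    by_cases ha0 : (Fin.snoc ω μ : Fin (N + 1) → ℝ) a = 0
    · by_cases hb0 : (Fin.snoc ω μ : Fin (N + 1) → ℝ) b = 0
      · rcases lt_trichotomy a b with hab | rfl | hab
        · exact h a b hab ha0 hb0
        · exact hc.alt _
        · rw [hc.skew, h b a hab hb0 ha0, neg_zero]
      · exact aux b _ hb hb0
    · rw [hc.skew, aux a _ ha ha0, neg_zero]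
  have key' : ∀ b, (b = Fin.last N → μ = 0) → ∀ s,
      c (cartan ω hμ (coroot b)) (cartan ω hμ s) = 0 := fun b hb =>
    eq_zero_of_coroot (fun l => key _ _ hb fun h => absurd h (Fin.castSucc_ne_last l))
      fun h0 => key _ _ hb fun _ => h0
  refine eq_zero_of_coroot (f := c (cartan ω hμ s)) (fun l => ?_) (fun h0 => ?_) t
  · rw [hc.skew, key' _ (fun h => absurd h (Fin.castSucc_ne_last l)), neg_zero]
  · rw [hc.skew, key' _ fun _ => h0, neg_zero]

/-- The linear form on the diagonal with prescribed values on the simple coroots. -/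
def corootForm (ω : Fin N → ℝ) (μ : ℝ) (y : Fin N → ℝ) : ck ω μ →ₗ[ℝ] ℝ :=
  (∑ l, y l • (partialSum l.castSucc ∘ₗ diagIm)) ∘ₗ (ck ω μ).toSubmodule.subtype

theorem corootForm_apply (y : Fin N → ℝ) (X : ck ω μ) :
    corootForm ω μ y X = ∑ l, y l * partialSum l.castSucc (diagIm X.1) := by
  rw [corootForm, LinearMap.comp_apply, LinearMap.sum_apply]
  rfl

theorem corootForm_of_diagIm (y : Fin N → ℝ) {X : ck ω μ} (hX : diagIm X.1 = 0) :
    corootForm ω μ y X = 0 := by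
  simp [corootForm_apply, hX]

theorem corootForm_coroot (hμ : μ * (1 - μ * (N + 1)) = 0) (y : Fin N → ℝ) (l : Fin N) :
    corootForm ω μ y (cartan ω hμ (coroot l.castSucc)) = y l := by
  simp [corootForm_apply, diagIm_cartan_coroot, partialSum_coroot]

variable (hμ) in
theorem IsCocycle.exists_eq_coboundary (hc : IsCocycle c)
    (hE : ∀ l : Fin N, ω l = 0 →
      planeValue c ⟨(l.castSucc, l.succ), Fin.castSucc_lt_succ⟩ = 0)
    (hD : ∀ a b : Fin (N + 1), a < b → (Fin.snoc ω μ : Fin (N + 1) → ℝ) a = 0 →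
      (Fin.snoc ω μ : Fin (N + 1) → ℝ) b = 0 →
      c (cartan ω hμ (coroot a)) (cartan ω hμ (coroot b)) = 0) :
    ∃ f : ck ω μ →ₗ[ℝ] ℝ, ∀ X Y, c X Y = f ⁅X, Y⁆ := by
  obtain ⟨f, hf⟩ := hc.exists_isNormal hμ
  have hc' := hc.sub_coboundary f
  set c' := c - coboundary f with hc'_def
  have hbr (l : Fin N) : ⁅rootVec ω μ ⟨(l.castSucc, l.succ), Fin.castSucc_lt_succ⟩ 1,
      rootVec ω μ ⟨(l.castSucc, l.succ), Fin.castSucc_lt_succ⟩ Complex.I⁆ =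
      (-(2 * ω l)) • cartan ω hμ (coroot l.castSucc) := by
    rw [lie_rootVec_self ω hμ, coroot_castSucc, omega_castSucc_succ, ← map_smul, neg_smul,
      ← smul_neg, neg_sub]
    simp
  -- Chosen so that `-(2 * ω l) * y l` is the area factor of the simple plane `l`. If `ω l = 0` the
  -- division yields `0`; the plane is then commutative, and its factor vanishes by `hE`.
  let y : Fin N → ℝ := fun l =>
    -planeValue c' ⟨(l.castSucc, l.succ), Fin.castSucc_lt_succ⟩ / (2 * ω l)
  let g := corootForm ω μ y
  have hc'' := hc'.sub_coboundary g
  have hn : IsNormal ω hμ (c' - coboundary g) := by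
    refine ⟨fun s p z => ?_, fun p q hpq z w => ?_⟩
    · rw [LinearMap.sub_apply, LinearMap.sub_apply, hf.cartan_root, coboundary_apply,
        lie_cartan_rootVec, corootForm_of_diagIm y (diagIm_rootMat ω p.2 _), sub_zero]
    · rw [LinearMap.sub_apply, LinearMap.sub_apply, hf.root_root p q hpq, coboundary_apply,
        corootForm_of_diagIm y (diagIm_lie_rootVec ω hpq z w), sub_zero]
  have hzero := hn.eq_zero hc'' (hc''.planeValue_eq_zero fun l => ?_)
    (hc''.cartan_cartan fun a b hab ha hb => ?_)
  · refine ⟨f + g, fun X Y => ?_⟩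
    have := hzero X Y
    simp only [hc'_def, LinearMap.sub_apply, coboundary_apply] at this
    rw [LinearMap.add_apply]
    linarith
  · rw [planeValue, LinearMap.sub_apply, LinearMap.sub_apply, coboundary_apply, hbr, map_smul,
      corootForm_coroot]
    change planeValue c' _ - _ = 0
    by_cases hl : ω l = 0
    · rw [hl, planeValue, hc'_def, LinearMap.sub_apply, LinearMap.sub_apply, coboundary_apply,
        hbr, hl]
      have := hE l hl
      rw [planeValue] at this
      simp [this]
    · simp only [y, smul_eq_mul]
      field_simp
      ring
  · rw [LinearMap.sub_apply, LinearMap.sub_apply, coboundary_apply, lie_cartan_cartan, map_zero,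
      hc'_def, LinearMap.sub_apply, LinearMap.sub_apply, coboundary_apply, lie_cartan_cartan,
      map_zero, hD a b hab ha hb, sub_zero, sub_zero]

end NormalCocycles

/-! ### Explicit cocycles: wedge forms and block forms -/

section DualCocycles

variable {N : ℕ} (ω : Fin N → ℝ) {μ : ℝ}

/-- If `ω l = 0`, all matrices are block lower triangular at `l`, so the upper left block of a
bracket is the commutator of the blocks and has trace zero. At the last index this is the trace of
the whole commutator. -/
theorem partialSum_diagIm_lie {a : Fin (N + 1)}
    (ha : (Fin.snoc ω μ : Fin (N + 1) → ℝ) a = 0) (X Y : ck ω μ) :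
    partialSum a (diagIm (⁅X, Y⁆ : ck ω μ).1) = 0 := by
  change partialSum a (diagIm ⁅X.1, Y.1⁆) = 0
  induction a using Fin.lastCases with
  | last =>
    rw [partialSum_last]
    exact sum_im_lie _ _
  | cast l =>
    have hl : ω l = 0 := by simpa using ha
    have hz (Z : ck ω μ) {i j : Fin (N + 1)} (hi : i ≤ l.castSucc) (hj : ¬ j ≤ l.castSucc) :
        Z.1 i j = 0 := by
      have hj' : l.castSucc < j := not_le.1 hj
      rw [Z.2.1 i j (hi.trans hj'.le), omega_eq_zero ω hl hi hj']
      simp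
    have h1 (i : Fin (N + 1)) (hi : i ≤ l.castSucc) : diagIm ⁅X.1, Y.1⁆ i =
        ∑ j, if j ≤ l.castSucc then (X.1 i j * Y.1 j i - Y.1 i j * X.1 j i).im else 0 := by
      rw [diagIm_apply, LieRing.of_associative_ring_bracket, Matrix.sub_apply, Matrix.mul_apply,
        Matrix.mul_apply, ← Finset.sum_sub_distrib, Complex.im_sum]
      refine Finset.sum_congr rfl fun j _ => ?_
      split_ifs with hj
      · rfl
      · rw [hz X hi hj, hz Y hi hj]
        simp
    set T := ∑ i, ∑ j, (if i ≤ l.castSucc ∧ j ≤ l.castSucc then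
      (X.1 i j * Y.1 j i - Y.1 i j * X.1 j i).im else 0) with hT
    have h2 : partialSum l.castSucc (diagIm ⁅X.1, Y.1⁆) = T := by
      rw [partialSum_apply]
      refine Finset.sum_congr rfl fun i _ => ?_
      split_ifs with hi
      · rw [h1 i hi]
        simp [hi]
      · simp [hi]
    -- Exchanging the two summation indices changes the sign of the summand.
    have h3 : T = -T := by
      conv_lhs => rw [hT, Finset.sum_comm]
      rw [hT, ← Finset.sum_neg_distrib]
      refine Finset.sum_congr rfl fun i _ => ?_
      rw [← Finset.sum_neg_distrib]
      refine Finset.sum_congr rfl fun j _ => ?_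
      by_cases h : i ≤ l.castSucc ∧ j ≤ l.castSucc
      · rw [if_pos h, if_pos h.symm, ← Complex.neg_im]
        congr 1
        ring
      · rw [if_neg h, if_neg fun h' => h h'.symm, neg_zero]
    rw [h2]
    linarith

/-- The exterior product of two partial sums of the diagonal. -/
def wedgeForm (μ : ℝ) (a b : Fin (N + 1)) : ck ω μ →ₗ[ℝ] ck ω μ →ₗ[ℝ] ℝ :=
  LinearMap.mk₂ ℝ (fun X Y => partialSum a (diagIm X.1) * partialSum b (diagIm Y.1) -
      partialSum b (diagIm X.1) * partialSum a (diagIm Y.1))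
    (fun X X' Y => by
      change partialSum a (diagIm (X.1 + X'.1)) * _ - partialSum b (diagIm (X.1 + X'.1)) * _ = _
      rw [map_add, map_add, map_add]
      ring)
    (fun r X Y => by
      change partialSum a (diagIm (r • X.1)) * _ - partialSum b (diagIm (r • X.1)) * _ = _
      rw [map_smul, map_smul, map_smul, smul_eq_mul, smul_eq_mul, smul_eq_mul]
      ring)
    (fun X Y Y' => by
      change _ * partialSum b (diagIm (Y.1 + Y'.1)) - _ * partialSum a (diagIm (Y.1 + Y'.1)) = _
      rw [map_add, map_add, map_add]
      ring)
    (fun r X Y => by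
      change _ * partialSum b (diagIm (r • Y.1)) - _ * partialSum a (diagIm (r • Y.1)) = _
      rw [map_smul, map_smul, map_smul, smul_eq_mul, smul_eq_mul, smul_eq_mul]
      ring)

theorem wedgeForm_apply (a b : Fin (N + 1)) (X Y : ck ω μ) : wedgeForm ω μ a b X Y =
    partialSum a (diagIm X.1) * partialSum b (diagIm Y.1) -
      partialSum b (diagIm X.1) * partialSum a (diagIm Y.1) := rfl

/-- Both linear forms vanish on brackets, so every term of the cocycle identity is zero. -/
theorem isCocycle_wedgeForm {a b : Fin (N + 1)}
    (ha : (Fin.snoc ω μ : Fin (N + 1) → ℝ) a = 0)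
    (hb : (Fin.snoc ω μ : Fin (N + 1) → ℝ) b = 0) : IsCocycle (wedgeForm ω μ a b) where
  alt X := by rw [wedgeForm_apply]; ring
  jac X Y Z := by
    simp only [wedgeForm_apply, partialSum_diagIm_lie ω ha, partialSum_diagIm_lie ω hb]
    ring

/-- The weights `ω_{a,l-1} ω_{lb}` for `a < l ≤ b`; they vanish for all other indices. -/
def weight (l : Fin N) (a b : Fin (N + 1)) : ℝ :=
  if a ≤ l.castSucc ∧ l.succ ≤ b then omega ω a l.castSucc * omega ω l.succ b else 0

/-- The upper left block of `Y` is skew-adjoint for the weights in their first index. The analogue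
for the lower right block and the second index is `weight_mul_conj_right`. -/
theorem weight_mul_conj_left (l : Fin N) {Y : Matrix (Fin (N + 1)) (Fin (N + 1)) ℂ}
    (hY : IsSkew ω Y) {a j : Fin (N + 1)} (ha : a ≤ l.castSucc) (hj : j ≤ l.castSucc)
    (b : Fin (N + 1)) :
    (weight ω l a b : ℂ) * conj (Y j a) = -(Y a j * weight ω l j b) := by
  by_cases hb : l.succ ≤ b
  · rw [weight, weight, if_pos ⟨ha, hb⟩, if_pos ⟨hj, hb⟩]
    rcases le_total a j with h | h
    · rw [hY a j h, ← omega_mul_omega ω h hj]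
      push_cast
      ring
    · rw [hY j a h, ← omega_mul_omega ω h ha]
      simp only [map_neg, map_mul, Complex.conj_conj, Complex.conj_ofReal]
      push_cast
      ring
  · rw [weight, weight, if_neg fun h => hb h.2, if_neg fun h => hb h.2]
    simp

theorem weight_mul_conj_right (l : Fin N) {X : Matrix (Fin (N + 1)) (Fin (N + 1)) ℂ}
    (hX : IsSkew ω X) {b j : Fin (N + 1)} (hb : l.succ ≤ b) (hj : l.succ ≤ j)
    (a : Fin (N + 1)) :
    (weight ω l a b : ℂ) * conj (X b j) = -(X j b * weight ω l a j) := by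
  by_cases ha : a ≤ l.castSucc
  · rw [weight, weight, if_pos ⟨ha, hb⟩, if_pos ⟨ha, hj⟩]
    rcases le_total j b with h | h
    · rw [hX j b h, ← omega_mul_omega ω hj h]
      push_cast
      ring
    · rw [hX b j h, ← omega_mul_omega ω hb h]
      simp only [map_neg, map_mul, Complex.conj_conj, Complex.conj_ofReal]
      push_cast
      ring
  · rw [weight, weight, if_neg fun h => ha h.1, if_neg fun h => ha h.1]
    simp

/-- The weighted symplectic form on the lower left block cut out by the index `l`. -/
def blockForm (μ : ℝ) (l : Fin N) : ck ω μ →ₗ[ℝ] ck ω μ →ₗ[ℝ] ℝ :=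
  LinearMap.mk₂ ℝ (fun X Y =>
      (∑ a, ∑ b, (weight ω l a b : ℂ) * (conj (X.1 b a) * Y.1 b a)).im)
    (fun X X' Y => by
      rw [← Complex.add_im, ← Finset.sum_add_distrib]
      simp only [← Finset.sum_add_distrib, ← mul_add, ← add_mul, ← map_add]
      rfl)
    (fun r X Y => by
      rw [smul_eq_mul, ← Complex.im_ofReal_mul, Finset.mul_sum]
      congr 1
      refine Finset.sum_congr rfl fun a _ => ?_
      rw [Finset.mul_sum]
      refine Finset.sum_congr rfl fun b _ => ?_
      change (weight ω l a b : ℂ) * (conj ((r : ℂ) * X.1 b a) * Y.1 b a) = _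
      rw [map_mul, Complex.conj_ofReal]
      ring)
    (fun X Y Y' => by
      rw [← Complex.add_im, ← Finset.sum_add_distrib]
      simp only [← Finset.sum_add_distrib, ← mul_add]
      rfl)
    (fun r X Y => by
      rw [smul_eq_mul, ← Complex.im_ofReal_mul, Finset.mul_sum]
      congr 1
      refine Finset.sum_congr rfl fun a _ => ?_
      rw [Finset.mul_sum]
      refine Finset.sum_congr rfl fun b _ => ?_
      change (weight ω l a b : ℂ) * (conj (X.1 b a) * ((r : ℂ) * Y.1 b a)) = _
      ring)

theorem blockForm_apply (l : Fin N) (X Y : ck ω μ) : blockForm ω μ l X Y =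
    (∑ a, ∑ b, (weight ω l a b : ℂ) * (conj (X.1 b a) * Y.1 b a)).im := rfl

/-- The part of the trilinear form `blockForm (X Y) Z` with inner index `≤ l - 1`. -/
def tripleLow (l : Fin N) (X Y Z : Matrix (Fin (N + 1)) (Fin (N + 1)) ℂ) : ℂ :=
  ∑ b, ∑ a, ∑ j, if a ≤ l.castSucc ∧ j ≤ l.castSucc then
    (weight ω l a b : ℂ) * (conj (X b j) * conj (Y j a) * Z b a) else 0

/-- The part of the trilinear form `blockForm (X Y) Z` with inner index `≥ l`. -/
def tripleHigh (l : Fin N) (X Y Z : Matrix (Fin (N + 1)) (Fin (N + 1)) ℂ) : ℂ :=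
  ∑ a, ∑ b, ∑ j, if l.succ ≤ b ∧ l.succ ≤ j then
    (weight ω l a b : ℂ) * (conj (X b j) * conj (Y j a) * Z b a) else 0

/-- Only `a ≤ l.castSucc` and `l.succ ≤ b` carry weight, and the inner index of the product falls on
exactly one side of the cut. -/
theorem sum_weight_mul (l : Fin N) (X Y Z : Matrix (Fin (N + 1)) (Fin (N + 1)) ℂ) :
    ∑ a, ∑ b, (weight ω l a b : ℂ) * (conj ((X * Y) b a) * Z b a) =
      tripleLow ω l X Y Z + tripleHigh ω l X Y Z := by
  have h : tripleLow ω l X Y Z = ∑ a, ∑ b, ∑ j, if a ≤ l.castSucc ∧ j ≤ l.castSucc then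
      (weight ω l a b : ℂ) * (conj (X b j) * conj (Y j a) * Z b a) else 0 := Finset.sum_comm
  rw [h, tripleHigh, ← Finset.sum_add_distrib]
  refine Finset.sum_congr rfl fun a _ => ?_
  rw [← Finset.sum_add_distrib]
  refine Finset.sum_congr rfl fun b _ => ?_
  rw [← Finset.sum_add_distrib, Matrix.mul_apply, map_sum, Finset.sum_mul, Finset.mul_sum]
  refine Finset.sum_congr rfl fun j _ => ?_
  rw [map_mul]
  by_cases hab : a ≤ l.castSucc ∧ l.succ ≤ b
  · by_cases hj : j ≤ l.castSucc
    · have hj' : ¬ l.succ ≤ j := fun h => absurd (h.trans hj) (not_le.2 Fin.castSucc_lt_succ)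
      rw [if_pos ⟨hab.1, hj⟩, if_neg fun h => hj' h.2, add_zero]
    · have hj' : l.succ ≤ j := Fin.castSucc_lt_iff_succ_le.1 (not_le.1 hj)
      rw [if_neg fun h => hj h.2, if_pos ⟨hab.2, hj'⟩, zero_add]
  · rw [weight, if_neg hab]
    simp

/-- Moving `Y` to the other argument by skew-adjointness gives minus the conjugate of the sum with
`X` and `Z` exchanged, which has the same imaginary part. -/
theorem im_tripleLow (l : Fin N) {X Y Z : Matrix (Fin (N + 1)) (Fin (N + 1)) ℂ}
    (hY : IsSkew ω Y) : (tripleLow ω l X Y Z).im = (tripleLow ω l Z Y X).im := by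
  have h : tripleLow ω l X Y Z = -conj (tripleLow ω l Z Y X) := by
    rw [tripleLow, tripleLow, map_sum, ← Finset.sum_neg_distrib]
    refine Finset.sum_congr rfl fun b _ => ?_
    rw [Finset.sum_comm, map_sum, ← Finset.sum_neg_distrib]
    refine Finset.sum_congr rfl fun a _ => ?_
    rw [map_sum, ← Finset.sum_neg_distrib]
    refine Finset.sum_congr rfl fun j _ => ?_
    by_cases h : a ≤ l.castSucc ∧ j ≤ l.castSucc
    · rw [if_pos h, if_pos h.symm]
      simp only [map_mul, Complex.conj_conj, Complex.conj_ofReal]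
      linear_combination (conj (X b a) * Z b j) * weight_mul_conj_left ω l hY h.2 h.1 b
    · rw [if_neg h, if_neg fun h' => h h'.symm, map_zero, neg_zero]
  rw [h]
  simp

theorem im_tripleHigh (l : Fin N) {X Y Z : Matrix (Fin (N + 1)) (Fin (N + 1)) ℂ}
    (hX : IsSkew ω X) : (tripleHigh ω l X Y Z).im = (tripleHigh ω l X Z Y).im := by
  have h : tripleHigh ω l X Y Z = -conj (tripleHigh ω l X Z Y) := by
    rw [tripleHigh, tripleHigh, map_sum, ← Finset.sum_neg_distrib]
    refine Finset.sum_congr rfl fun a _ => ?_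
    rw [Finset.sum_comm, map_sum, ← Finset.sum_neg_distrib]
    refine Finset.sum_congr rfl fun b _ => ?_
    rw [map_sum, ← Finset.sum_neg_distrib]
    refine Finset.sum_congr rfl fun j _ => ?_
    by_cases h : l.succ ≤ b ∧ l.succ ≤ j
    · rw [if_pos h, if_pos h.symm]
      simp only [map_mul, Complex.conj_conj, Complex.conj_ofReal]
      linear_combination (conj (Y b a) * Z j a) * weight_mul_conj_right ω l hX h.2 h.1 a
    · rw [if_neg h, if_neg fun h' => h h'.symm, map_zero, neg_zero]
  rw [h]
  simp

theorem blockForm_lie (l : Fin N) (X Y Z : ck ω μ) : blockForm ω μ l ⁅X, Y⁆ Z =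
    (tripleLow ω l X.1 Y.1 Z.1).im + (tripleHigh ω l X.1 Y.1 Z.1).im -
      (tripleLow ω l Y.1 X.1 Z.1).im - (tripleHigh ω l Y.1 X.1 Z.1).im := by
  have h : ∑ a, ∑ b, (weight ω l a b : ℂ) * (conj ((⁅X, Y⁆ : ck ω μ).1 b a) * Z.1 b a) =
      tripleLow ω l X.1 Y.1 Z.1 + tripleHigh ω l X.1 Y.1 Z.1 -
        (tripleLow ω l Y.1 X.1 Z.1 + tripleHigh ω l Y.1 X.1 Z.1) := by
    rw [← sum_weight_mul, ← sum_weight_mul, ← Finset.sum_sub_distrib]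
    refine Finset.sum_congr rfl fun a _ => ?_
    rw [← Finset.sum_sub_distrib]
    refine Finset.sum_congr rfl fun b _ => ?_
    change _ * (conj ((X.1 * Y.1) b a - (Y.1 * X.1) b a) * _) = _
    rw [map_sub]
    ring
  rw [blockForm_apply, h]
  simp only [Complex.sub_im, Complex.add_im]
  ring

/-- Conceptually, `-2 * ω l` times `blockForm` is the coboundary of the partial sum at `l`, because
`ω_{ab}` is `ω l` times the weight across the cut; dividing by `ω l` leaves a formula that is still
a cocycle when `ω l = 0`. The direct check uses the symmetries of `tripleLow` and `tripleHigh`,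
under which the twelve terms cancel in pairs. -/
theorem isCocycle_blockForm (l : Fin N) : IsCocycle (blockForm ω μ l) where
  alt X := by
    rw [blockForm_apply, Complex.im_sum]
    refine Finset.sum_eq_zero fun a _ => ?_
    rw [Complex.im_sum]
    refine Finset.sum_eq_zero fun b _ => ?_
    rw [Complex.im_ofReal_mul, Complex.mul_im, Complex.conj_re, Complex.conj_im]
    ring
  jac X Y Z := by
    rw [blockForm_lie, blockForm_lie, blockForm_lie, im_tripleLow ω l Y.2.1,
      im_tripleLow ω l Z.2.1, im_tripleLow ω l X.2.1, im_tripleHigh ω l X.2.1,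
      im_tripleHigh ω l Y.2.1, im_tripleHigh ω l Z.2.1]
    ring

end DualCocycles

/-! ### The dual basis of the cohomology and its cardinality -/

section Basis

variable {N : ℕ} (ω : Fin N → ℝ) {μ : ℝ} (hμ : μ * (1 - μ * (N + 1)) = 0)

/-- The pairs of indices at which `ω`, extended by `μ`, vanishes. -/
abbrev ZeroPair (μ : ℝ) : Type :=
  {p : Pair N // (Fin.snoc ω μ : Fin (N + 1) → ℝ) p.1.1 = 0 ∧
    (Fin.snoc ω μ : Fin (N + 1) → ℝ) p.1.2 = 0}

/-- The root plane attached to a simple root. -/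
def simplePair (l : Fin N) : Pair N := ⟨(l.castSucc, l.succ), Fin.castSucc_lt_succ⟩

/-- First members of the pairs of commuting elements detecting the second cohomology. -/
def basisFst : {l : Fin N // ω l = 0} ⊕ ZeroPair ω μ → ck ω μ :=
  Sum.elim (fun l => rootVec ω μ (simplePair l.1) 1) fun p => cartan ω hμ (coroot p.1.1.1)

/-- Second members of the pairs of commuting elements detecting the second cohomology. -/
def basisSnd : {l : Fin N // ω l = 0} ⊕ ZeroPair ω μ → ck ω μ :=
  Sum.elim (fun l => rootVec ω μ (simplePair l.1) Complex.I)
    fun p => cartan ω hμ (coroot p.1.1.2)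

theorem blockForm_rootVec (l m : Fin N) (z w : ℂ) :
    blockForm ω μ l (rootVec ω μ (simplePair m) z) (rootVec ω μ (simplePair m) w) =
      if l = m then (starRingEnd ℂ z * w).im else 0 := by
  have hlt : m.castSucc < m.succ := Fin.castSucc_lt_succ
  have hval (z : ℂ) (i j : Fin (N + 1)) : (rootVec ω μ (simplePair m) z).1 i j =
      if i = m.succ ∧ j = m.castSucc then z else if i = m.castSucc ∧ j = m.succ then
        -((omega ω m.castSucc m.succ : ℂ) * starRingEnd ℂ z) else 0 :=
    rootMat_apply ω hlt z i j
  -- A simple plane `m` crosses the cut at `l` only for `m = l`, and then both coefficients are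
  -- empty products.
  have hw : weight ω l m.castSucc m.succ = if l = m then 1 else 0 := by
    rw [weight]
    by_cases h : l = m
    · subst h
      rw [if_pos ⟨le_rfl, le_rfl⟩, if_pos rfl, omega_self, omega_self, one_mul]
    · rw [if_neg h, if_neg]
      rintro ⟨h1, h2⟩
      exact h (le_antisymm (Fin.succ_le_succ_iff.1 h2) (Fin.castSucc_le_castSucc_iff.1 h1))
  have hw' : weight ω l m.succ m.castSucc = 0 := by
    rw [weight, if_neg]
    rintro ⟨h1, h2⟩
    exact absurd ((h2.trans hlt.le).trans h1) (not_le.2 Fin.castSucc_lt_succ)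
  have hsum : ∑ a, ∑ b, (weight ω l a b : ℂ) *
      (starRingEnd ℂ ((rootVec ω μ (simplePair m) z).1 b a) *
        (rootVec ω μ (simplePair m) w).1 b a) =
      (weight ω l m.castSucc m.succ : ℂ) * (starRingEnd ℂ z * w) := by
    rw [Finset.sum_eq_single m.castSucc, Finset.sum_eq_single m.succ]
    · rw [hval, hval, if_pos ⟨rfl, rfl⟩, if_pos ⟨rfl, rfl⟩]
    · intro b _ hb
      rw [hval, if_neg fun h => hb h.1, if_neg fun h => hlt.ne h.2, map_zero, zero_mul, mul_zero]
    · simp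
    · intro a _ ha
      refine Finset.sum_eq_zero fun b _ => ?_
      by_cases h : b = m.castSucc ∧ a = m.succ
      · rw [h.1, h.2, hw']
        simp
      · rw [hval, if_neg fun h => ha h.2, if_neg h, map_zero, zero_mul, mul_zero]
    · simp
  rw [blockForm_apply, hsum, hw]
  split_ifs <;> simp

theorem blockForm_cartan (l : Fin N) (s t : Fin (N + 1) → ℝ) :
    blockForm ω μ l (cartan ω hμ s) (cartan ω hμ t) = 0 := by
  have : ∑ a, ∑ b, (weight ω l a b : ℂ) *
      (starRingEnd ℂ ((cartan ω hμ s).1 b a) * (cartan ω hμ t).1 b a) = 0 := by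
    refine Finset.sum_eq_zero fun a _ => Finset.sum_eq_zero fun b _ => ?_
    by_cases h : b = a
    · subst h
      rw [weight, if_neg]
      · simp
      · rintro ⟨h1, h2⟩
        exact absurd (h2.trans h1) (not_le.2 Fin.castSucc_lt_succ)
    · rw [coe_cartan, diagMat_apply_of_ne _ _ h]
      simp
  rw [blockForm_apply, this, Complex.zero_im]

theorem diagIm_coroot {a : Fin (N + 1)} (ha : (Fin.snoc ω μ : Fin (N + 1) → ℝ) a = 0) :
    diagIm (cartan ω hμ (coroot a)).1 = coroot a := by
  induction a using Fin.lastCases with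
  | last =>
    have h0 : μ = 0 := by simpa using ha
    rw [coe_cartan, diagIm_diagMat, h0, zero_mul, zero_smul, sub_zero]
  | cast l => exact diagIm_cartan_coroot hμ l

theorem isH2Basis_ck : IsH2Basis (ck ω μ) (basisFst ω hμ) (basisSnd ω hμ) where
  comm := by
    rintro (⟨l, hl⟩ | p)
    · change ⁅rootVec ω μ (simplePair l) 1, rootVec ω μ (simplePair l) Complex.I⁆ = 0
      rw [lie_rootVec_self ω hμ]
      have : omega ω (simplePair l).1.1 (simplePair l).1.2 = 0 :=
        (omega_castSucc_succ ω l).trans hl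
      rw [this, mul_zero, zero_mul, zero_smul, map_zero]
    · exact lie_cartan_cartan ω hμ _ _
  exact c hc h := hc.exists_eq_coboundary hμ (fun l hl => h (Sum.inl ⟨l, hl⟩))
    fun a b hab ha hb => h (Sum.inr ⟨⟨(a, b), hab⟩, ha, hb⟩)
  dual := by
    rintro (⟨l, hl⟩ | ⟨⟨⟨a, b⟩, hab⟩, ha, hb⟩)
    · refine ⟨blockForm ω μ l, isCocycle_blockForm ω l, ?_, ?_⟩
      · refine (blockForm_rootVec ω l l 1 Complex.I).trans ?_
        simp
      · rintro (⟨m, hm⟩ | q) hne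
        · refine (blockForm_rootVec ω l m 1 Complex.I).trans (if_neg ?_)
          rintro rfl
          exact hne rfl
        · exact blockForm_cartan ω hμ l _ _
    · refine ⟨wedgeForm ω μ a b, isCocycle_wedgeForm ω ha hb, ?_, ?_⟩
      · change wedgeForm ω μ a b (cartan ω hμ (coroot a)) (cartan ω hμ (coroot b)) = 1
        rw [wedgeForm_apply, diagIm_coroot ω hμ ha, diagIm_coroot ω hμ hb]
        have h : (a : Fin (N + 1)) ≠ b := hab.ne
        simp [partialSum_coroot, h]
      · rintro (⟨m, hm⟩ | ⟨⟨⟨a', b'⟩, hab'⟩, ha', hb'⟩) hne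
        · change wedgeForm ω μ a b (rootVec ω μ (simplePair m) 1)
            (rootVec ω μ (simplePair m) Complex.I) = 0
          rw [wedgeForm_apply, coe_rootVec, diagIm_rootMat ω (simplePair m).2]
          simp
        · change wedgeForm ω μ a b (cartan ω hμ (coroot a')) (cartan ω hμ (coroot b')) = 0
          rw [wedgeForm_apply, diagIm_coroot ω hμ ha', diagIm_coroot ω hμ hb']
          simp only [partialSum_coroot]
          have h1 : ¬ (a = a' ∧ b = b') := by
            rintro ⟨rfl, rfl⟩
            exact hne rfl
          have h2 : ¬ (b = a' ∧ a = b') := by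
            rintro ⟨rfl, rfl⟩
            exact lt_asymm hab hab'
          rw [ite_zero_mul_ite_zero, ite_zero_mul_ite_zero, if_neg h1, if_neg h2, sub_zero]

/-- Swapping coordinates exchanges the two halves of the off-diagonal pairs. -/
theorem two_mul_card_lt {α : Type} [LinearOrder α] [Fintype α] (S : Finset α) :
    2 * (S.offDiag.filter fun p => p.1 < p.2).card + S.card = S.card * S.card := by
  have h1 : (S.offDiag.filter fun p => ¬ p.1 < p.2).card =
      (S.offDiag.filter fun p => p.1 < p.2).card := by
    refine Finset.card_bij (fun p _ => p.swap) ?_ ?_ ?_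
    · rintro ⟨a, b⟩ h
      simp only [Finset.mem_filter, Finset.mem_offDiag, Prod.swap, not_lt] at h ⊢
      exact ⟨⟨h.1.2.1, h.1.1, h.1.2.2.symm⟩, lt_of_le_of_ne h.2 h.1.2.2.symm⟩
    · intro p _ q _ h
      exact Prod.swap_injective h
    · rintro ⟨a, b⟩ h
      simp only [Finset.mem_filter, Finset.mem_offDiag] at h
      refine ⟨(b, a), ?_, rfl⟩
      simp only [Finset.mem_filter, Finset.mem_offDiag, not_lt]
      exact ⟨⟨h.1.2.1, h.1.1, h.1.2.2.symm⟩, h.2.le⟩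
  have h2 := Finset.card_filter_add_card_filter_not (s := S.offDiag) (fun p => p.1 < p.2)
  rw [h1, Finset.offDiag_card] at h2
  have h3 : S.card ≤ S.card * S.card := Nat.le_mul_self _
  omega

open scoped Classical in
theorem two_mul_card_zeroPair :
    2 * Fintype.card (ZeroPair ω μ) + (Fintype.card {l // ω l = 0} + if μ = 0 then 1 else 0) =
      (Fintype.card {l // ω l = 0} + if μ = 0 then 1 else 0) *
        (Fintype.card {l // ω l = 0} + if μ = 0 then 1 else 0) := by
  set S : Finset (Fin (N + 1)) :=
    Finset.univ.filter fun a => (Fin.snoc ω μ : Fin (N + 1) → ℝ) a = 0 with hS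
  have h1 : S.card = Fintype.card {l // ω l = 0} + if μ = 0 then 1 else 0 := by
    rw [hS, Finset.card_filter, Fin.sum_univ_castSucc, Fintype.card_subtype, Finset.card_filter]
    simp
  have h2 : Fintype.card (ZeroPair ω μ) = (S.offDiag.filter fun p => p.1 < p.2).card := by
    rw [← Fintype.card_coe]
    refine Fintype.card_congr
      { toFun := fun p => ⟨p.1.1, ?_⟩
        invFun := fun p => ⟨⟨p.1, ?_⟩, ?_⟩
        left_inv := fun p => rfl
        right_inv := fun p => rfl }
    · simp only [hS, Finset.mem_filter, Finset.mem_offDiag, Finset.mem_univ, true_and]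
      exact ⟨⟨p.2.1, p.2.2, p.1.2.ne⟩, p.1.2⟩
    · exact (Finset.mem_filter.1 p.2).2
    · have := Finset.mem_offDiag.1 (Finset.mem_filter.1 p.2).1
      exact ⟨(Finset.mem_filter.1 this.1).2, (Finset.mem_filter.1 this.2.1).2⟩
  rw [h2, ← h1]
  exact two_mul_card_lt S

open scoped Classical in
theorem card_basis_su (hμ0 : μ ≠ 0) :
    Fintype.card ({l : Fin N // ω l = 0} ⊕ ZeroPair ω μ) =
      Nat.card {l : Fin N // ω l = 0} * (Nat.card {l : Fin N // ω l = 0} + 1) / 2 := by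
  have h := two_mul_card_zeroPair ω (μ := μ)
  rw [if_neg hμ0, add_zero] at h
  rw [Nat.card_eq_fintype_card, Fintype.card_sum]
  symm
  apply Nat.div_eq_of_eq_mul_right two_pos
  rw [mul_add, mul_add, mul_one, ← h]
  ring

open scoped Classical in
theorem card_basis_u : Fintype.card ({l : Fin N // ω l = 0} ⊕ ZeroPair ω 0) =
    Nat.card {l : Fin N // ω l = 0} * (Nat.card {l : Fin N // ω l = 0} + 3) / 2 := by
  have h := two_mul_card_zeroPair ω (μ := 0)
  rw [if_pos rfl] at h
  rw [Nat.card_eq_fintype_card, Fintype.card_sum]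
  symm
  apply Nat.div_eq_of_eq_mul_right two_pos
  linarith

open scoped Classical in
/-- A real Lie algebra isomorphic to a special unitary Cayley--Klein algebra has second cohomology
of dimension `n (n + 1) / 2`. -/
theorem rank_H2_of_equiv_ck {L : Type} [LieRing L] [LieAlgebra ℝ L]
    (e : ck ω (N + 1 : ℝ)⁻¹ ≃ₗ⁅ℝ⁆ L) : Module.rank ℝ (H2 L) =
      ((Nat.card {l : Fin N // ω l = 0} * (Nat.card {l : Fin N // ω l = 0} + 1) / 2 : ℕ) :
        Cardinal) := by
  rw [((isH2Basis_ck ω inv_mul_self_eq_zero).congr e).rank_eq, card_basis_su ω (by positivity)]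

open scoped Classical in
/-- A real Lie algebra isomorphic to a unitary Cayley--Klein algebra has second cohomology
of dimension `n (n + 3) / 2`. -/
theorem rank_H2_of_equiv_ck_zero {L : Type} [LieRing L] [LieAlgebra ℝ L]
    (e : ck ω 0 ≃ₗ⁅ℝ⁆ L) : Module.rank ℝ (H2 L) =
      ((Nat.card {l : Fin N // ω l = 0} * (Nat.card {l : Fin N // ω l = 0} + 3) / 2 : ℕ) :
        Cardinal) := by
  have h0 : (0 : ℝ) * (1 - 0 * (N + 1)) = 0 := by simp
  rw [((isH2Basis_ck ω h0).congr e).rank_eq, card_basis_u ω]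

theorem rank_H2_su : Module.rank ℝ (H2 (su ω)) =
    ((Nat.card {l : Fin N // ω l = 0} * (Nat.card {l : Fin N // ω l = 0} + 1) / 2 : ℕ) :
      Cardinal) := by
  rw [su_eq_ck]
  exact rank_H2_of_equiv_ck ω LieEquiv.refl

theorem rank_H2_u : Module.rank ℝ (H2 (u ω)) =
    ((Nat.card {l : Fin N // ω l = 0} * (Nat.card {l : Fin N // ω l = 0} + 3) / 2 : ℕ) :
      Cardinal) := by
  rw [u_eq_ck]
  exact rank_H2_of_equiv_ck_zero ω LieEquiv.refl

end Basis

/-! ### Pseudo-unitary algebras: all parameters nonzero -/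

section PseudoUnitaryEquiv

/-- Lie algebras of matrices corresponding to each other under a reindexing are isomorphic. -/
def equivOfReindex {m n : Type} [Fintype m] [DecidableEq m] [Fintype n] [DecidableEq n]
    (e : m ≃ n) {K : LieSubalgebra ℝ (Matrix m m ℂ)} {K' : LieSubalgebra ℝ (Matrix n n ℂ)}
    (h : ∀ X, X ∈ K ↔ X.submatrix e.symm e.symm ∈ K') : K' ≃ₗ⁅ℝ⁆ K where
  toFun Y := ⟨Y.1.submatrix e e, (h _).2 (by simp)⟩
  invFun X := ⟨X.1.submatrix e.symm e.symm, (h _).1 X.2⟩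
  left_inv Y := Subtype.ext (by simp)
  right_inv X := Subtype.ext (by simp)
  map_add' _ _ := rfl
  map_smul' _ _ := rfl
  map_lie' {X Y} := Subtype.ext (by
    change (X.1 * Y.1 - Y.1 * X.1).submatrix e e =
      X.1.submatrix e e * Y.1.submatrix e e - Y.1.submatrix e e * X.1.submatrix e e
    rw [Matrix.submatrix_mul_equiv, Matrix.submatrix_mul_equiv]
    rfl)

/-- The diagonal entries of the indefinite form. -/
def sgn (p q : ℕ) : Fin p ⊕ Fin q → ℝ := Sum.elim (fun _ => 1) fun _ => -1

theorem sgn_mul_self (p q : ℕ) (i : Fin p ⊕ Fin q) : sgn p q i * sgn p q i = 1 := by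
  rcases i with i | i <;> simp [sgn]

theorem mem_uPQ {p q : ℕ} {X : Matrix (Fin p ⊕ Fin q) (Fin p ⊕ Fin q) ℂ} :
    X ∈ uPQ p q ↔ ∀ i j, X i j = -((sgn p q i * sgn p q j : ℝ) * conj (X j i)) := by
  have hI : LieAlgebra.Orthogonal.indefiniteDiagonal (Fin p) (Fin q) ℂ =
      Matrix.diagonal fun i => (sgn p q i : ℂ) := by
    rw [LieAlgebra.Orthogonal.indefiniteDiagonal]
    congr 1
    funext i
    rcases i with i | i <;> simp [sgn]
  change Xᴴ * LieAlgebra.Orthogonal.indefiniteDiagonal (Fin p) (Fin q) ℂ +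
    LieAlgebra.Orthogonal.indefiniteDiagonal (Fin p) (Fin q) ℂ * X = 0 ↔ _
  rw [hI, ← Matrix.ext_iff]
  refine forall_congr' fun i => forall_congr' fun j => ?_
  rw [Matrix.add_apply, Matrix.mul_diagonal, Matrix.diagonal_mul, Matrix.conjTranspose_apply,
    Matrix.zero_apply]
  have hs : (sgn p q i : ℂ) * sgn p q i = 1 := by
    rw [← Complex.ofReal_mul, sgn_mul_self, Complex.ofReal_one]
  change conj (X j i) * _ + _ = 0 ↔ _
  push_cast
  constructor
  · intro h
    linear_combination (sgn p q i : ℂ) * h - X i j * hs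
  · intro h
    linear_combination (sgn p q i : ℂ) * h - (sgn p q j * conj (X j i)) * hs

variable {p q N : ℕ}

/-- The Cayley--Klein parameters of the pseudo-unitary algebras. -/
def signParam (e : Fin p ⊕ Fin q ≃ Fin (N + 1)) (k : Fin N) : ℝ :=
  sgn p q (e.symm k.castSucc) * sgn p q (e.symm k.succ)

theorem signParam_ne_zero (e : Fin p ⊕ Fin q ≃ Fin (N + 1)) (k : Fin N) :
    signParam e k ≠ 0 :=
  mul_ne_zero (left_ne_zero_of_mul_eq_one (sgn_mul_self p q _))
    (left_ne_zero_of_mul_eq_one (sgn_mul_self p q _))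

/-- The product telescopes, since each intermediate sign occurs twice. -/
theorem omega_signParam (e : Fin p ⊕ Fin q ≃ Fin (N + 1)) {a b : Fin (N + 1)} (hab : a ≤ b) :
    omega (signParam e) a b = sgn p q (e.symm a) * sgn p q (e.symm b) := by
  induction b using Fin.induction with
  | zero =>
    obtain rfl := Fin.le_zero_iff.1 hab
    rw [omega_self, sgn_mul_self]
  | succ l ih =>
    rcases eq_or_lt_of_le hab with rfl | hlt
    · rw [omega_self, sgn_mul_self]
    · have hle : a ≤ l.castSucc := Fin.le_castSucc_iff.2 hlt
      rw [← omega_mul_omega _ hle Fin.castSucc_lt_succ.le, ih hle, omega_castSucc_succ, signParam]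
      linear_combination (sgn p q (e.symm a) * sgn p q (e.symm l.succ)) *
        sgn_mul_self p q (e.symm l.castSucc)

theorem mem_uPQ_iff_isSkew (e : Fin p ⊕ Fin q ≃ Fin (N + 1))
    (X : Matrix (Fin p ⊕ Fin q) (Fin p ⊕ Fin q) ℂ) :
    X ∈ uPQ p q ↔ IsSkew (signParam e) (X.submatrix e.symm e.symm) := by
  rw [mem_uPQ]
  constructor
  · intro h a b hab
    rw [omega_signParam e hab, Matrix.submatrix_apply, Matrix.submatrix_apply, h]
  · intro h
    have key (i j) (hij : e i ≤ e j) :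
        X i j = -((sgn p q i * sgn p q j : ℝ) * conj (X j i)) := by
      have := h (e i) (e j) hij
      rw [omega_signParam e hij] at this
      simpa using this
    intro i j
    rcases le_total (e i) (e j) with hij | hij
    · exact key i j hij
    · have hi : (sgn p q i : ℂ) * sgn p q i = 1 := by
        rw [← Complex.ofReal_mul, sgn_mul_self, Complex.ofReal_one]
      have hj : (sgn p q j : ℂ) * sgn p q j = 1 := by
        rw [← Complex.ofReal_mul, sgn_mul_self, Complex.ofReal_one]
      rw [key j i hij]
      simp only [map_neg, map_mul, Complex.conj_conj, Complex.conj_ofReal]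
      push_cast
      linear_combination (-(sgn p q j : ℂ) * sgn p q j * X i j) * hi - X i j * hj

theorem mem_uPQ_iff (e : Fin p ⊕ Fin q ≃ Fin (N + 1))
    (X : Matrix (Fin p ⊕ Fin q) (Fin p ⊕ Fin q) ℂ) :
    X ∈ uPQ p q ↔ X.submatrix e.symm e.symm ∈ ck (signParam e) 0 := by
  rw [mem_uPQ_iff_isSkew e, mem_ck]
  simp

theorem re_trace_eq_zero {X : Matrix (Fin p ⊕ Fin q) (Fin p ⊕ Fin q) ℂ} (hX : X ∈ uPQ p q) :
    X.trace.re = 0 := by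
  rw [Matrix.trace, Complex.re_sum]
  refine Finset.sum_eq_zero fun i _ => ?_
  have h := mem_uPQ.1 hX i i
  rw [sgn_mul_self] at h
  have := congrArg Complex.re h
  simp at this
  rw [Matrix.diag_apply]
  linarith

theorem mem_suPQ_iff (e : Fin p ⊕ Fin q ≃ Fin (N + 1))
    (X : Matrix (Fin p ⊕ Fin q) (Fin p ⊕ Fin q) ℂ) :
    X ∈ suPQ p q ↔ X.submatrix e.symm e.symm ∈ ck (signParam e) (N + 1 : ℝ)⁻¹ := by
  have hN : (N + 1 : ℝ)⁻¹ ≠ 0 := by positivity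
  have htr : ∑ a, (X.submatrix e.symm e.symm a a).im = X.trace.im := by
    rw [Matrix.trace, Complex.im_sum]
    exact e.symm.sum_comp fun i => (X i i).im
  rw [mem_ck, htr, ← mem_uPQ_iff_isSkew e, mul_eq_zero, or_iff_right hN]
  change X ∈ uPQ p q ∧ X.trace = 0 ↔ _
  refine and_congr_right fun hX => ?_
  rw [Complex.ext_iff, re_trace_eq_zero hX]
  simp

theorem card_signParam_eq_zero (e : Fin p ⊕ Fin q ≃ Fin (N + 1)) :
    Nat.card {l : Fin N // signParam e l = 0} = 0 := by
  have : IsEmpty {l : Fin N // signParam e l = 0} := ⟨fun l => signParam_ne_zero e l.1 l.2⟩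
  exact Nat.card_of_isEmpty

/-- An enumeration of the index set of the pseudo-unitary algebra. -/
def indexEquiv (h : p + q = N + 1) : Fin p ⊕ Fin q ≃ Fin (N + 1) :=
  finSumFinEquiv.trans (finCongr h)

theorem rank_H2_eq_zero_of_subsingleton (L : Type) [LieRing L] [LieAlgebra ℝ L]
    [Subsingleton L] : Module.rank ℝ (H2 L) = 0 := by
  rw [(isH2Basis_of_subsingleton (L := L)).rank_eq]
  simp

theorem rank_H2_suPQ (e : Fin p ⊕ Fin q ≃ Fin (N + 1)) :
    Module.rank ℝ (H2 (suPQ p q)) = 0 := by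
  have h := rank_H2_of_equiv_ck (signParam e) (equivOfReindex e (mem_suPQ_iff e))
  rw [card_signParam_eq_zero] at h
  exact h.trans Nat.cast_zero

theorem rank_H2_uPQ (e : Fin p ⊕ Fin q ≃ Fin (N + 1)) :
    Module.rank ℝ (H2 (uPQ p q)) = 0 := by
  have h := rank_H2_of_equiv_ck_zero (signParam e) (equivOfReindex e (mem_uPQ_iff e))
  rw [card_signParam_eq_zero] at h
  exact h.trans Nat.cast_zero

theorem rank_H2_suPQ_uPQ (p q : ℕ) :
    Module.rank ℝ (H2 (suPQ p q)) = 0 ∧ Module.rank ℝ (H2 (uPQ p q)) = 0 := by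
  -- For `p + q = 0` there is no enumeration by `Fin (N + 1)`, but both algebras are zero.
  rcases Nat.eq_zero_or_pos (p + q) with h | h
  · have hempty : IsEmpty (Fin p ⊕ Fin q) := by
      rw [← Fintype.card_eq_zero_iff, Fintype.card_sum, Fintype.card_fin, Fintype.card_fin]
      exact h
    have h1 : Subsingleton (suPQ p q) :=
      ⟨fun X Y => Subtype.ext (Matrix.ext fun i => hempty.elim i)⟩
    have h2 : Subsingleton (uPQ p q) :=
      ⟨fun X Y => Subtype.ext (Matrix.ext fun i => hempty.elim i)⟩
    exact ⟨rank_H2_eq_zero_of_subsingleton (suPQ p q), rank_H2_eq_zero_of_subsingleton (uPQ p q)⟩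
  · have hN : p + q = (p + q - 1) + 1 := by omega
    exact ⟨rank_H2_suPQ (indexEquiv hN), rank_H2_uPQ (indexEquiv hN)⟩

end PseudoUnitaryEquiv

/-! ### The inhomogeneous algebra as traceless affine matrices -/

section Inhomogeneous

variable {p q m : ℕ}

/-- The affine matrix with linear part `X` and translation part `v`. -/
def affineMat (e : Fin p ⊕ Fin q ≃ Fin (m + 1)) (v : Fin p ⊕ Fin q → ℂ)
    (X : Matrix (Fin p ⊕ Fin q) (Fin p ⊕ Fin q) ℂ) : Matrix (Fin (m + 2)) (Fin (m + 2)) ℂ :=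
  fun i j => Fin.cases 0
    (fun a => Fin.cases (v (e.symm a)) (fun b => X (e.symm a) (e.symm b)) j) i

section
variable (e : Fin p ⊕ Fin q ≃ Fin (m + 1)) (v w : Fin p ⊕ Fin q → ℂ)
  (X Y : Matrix (Fin p ⊕ Fin q) (Fin p ⊕ Fin q) ℂ)

@[simp] theorem affineMat_zero (j : Fin (m + 2)) : affineMat e v X 0 j = 0 := rfl

@[simp] theorem affineMat_succ_zero (a : Fin (m + 1)) :
    affineMat e v X a.succ 0 = v (e.symm a) := rfl

@[simp] theorem affineMat_succ_succ (a b : Fin (m + 1)) :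
    affineMat e v X a.succ b.succ = X (e.symm a) (e.symm b) := rfl

theorem affineMat_mul :
    affineMat e v X * affineMat e w Y = affineMat e (X *ᵥ w) (X * Y) := by
  ext i j
  rw [Matrix.mul_apply, Fin.sum_univ_succ]
  induction i using Fin.cases with
  | zero => simp
  | succ a =>
    induction j using Fin.cases with
    | zero =>
      simp only [affineMat_succ_zero, affineMat_succ_succ, affineMat_zero, mul_zero, zero_add]
      exact e.symm.sum_comp fun k => X (e.symm a) k * w k
    | succ b =>
      simp only [affineMat_succ_zero, affineMat_succ_succ, affineMat_zero, mul_zero, zero_add]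
      rw [Matrix.mul_apply]
      exact e.symm.sum_comp fun k => X (e.symm a) k * Y k (e.symm b)

theorem affineMat_add :
    affineMat e (v + w) (X + Y) = affineMat e v X + affineMat e w Y := by
  ext i j
  rw [Matrix.add_apply]
  induction i using Fin.cases with
  | zero => simp
  | succ a => induction j using Fin.cases with
    | zero => rfl
    | succ b => rfl

theorem affineMat_sub :
    affineMat e (v - w) (X - Y) = affineMat e v X - affineMat e w Y := by
  ext i j
  rw [Matrix.sub_apply]
  induction i using Fin.cases with
  | zero => simp
  | succ a => induction j using Fin.cases with
    | zero => rfl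
    | succ b => rfl

theorem affineMat_smul (c : ℝ) : affineMat e (c • v) (c • X) = c • affineMat e v X := by
  ext i j
  rw [Matrix.smul_apply]
  induction i using Fin.cases with
  | zero => simp
  | succ a => induction j using Fin.cases with
    | zero => rfl
    | succ b => rfl

theorem sum_im_affineMat : ∑ i, (affineMat e v X i i).im = X.trace.im := by
  rw [Fin.sum_univ_succ]
  simp only [affineMat_zero, affineMat_succ_succ, Complex.zero_im, zero_add]
  rw [Matrix.trace, Complex.im_sum]
  exact e.symm.sum_comp fun i => (X i i).im

end

theorem omega_cons_zero (ω : Fin m → ℝ) (b : Fin (m + 1)) :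
    omega (Fin.cons 0 ω) 0 b.succ = 0 :=
  omega_eq_zero _ (l := 0) rfl le_rfl (by simp)

theorem omega_cons_succ (ω : Fin m → ℝ) (a b : Fin (m + 1)) :
    omega (Fin.cons 0 ω) a.succ b.succ = omega ω a b := by
  rw [omega, omega, Fin.prod_univ_succ, if_neg (by simp), one_mul]
  simp

/-- The first parameter is `0`, so row `0` must vanish off the diagonal while column `0` is free to
hold the translation. -/
theorem isSkew_affineMat (e : Fin p ⊕ Fin q ≃ Fin (m + 1)) (v : Fin p ⊕ Fin q → ℂ)
    {X : Matrix (Fin p ⊕ Fin q) (Fin p ⊕ Fin q) ℂ} (hX : X ∈ uPQ p q) :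
    IsSkew (Fin.cons 0 (signParam e)) (affineMat e v X) := by
  intro a b hab
  induction a using Fin.cases with
  | zero =>
    induction b using Fin.cases with
    | zero => simp
    | succ b => simp [omega_cons_zero]
  | succ a =>
    induction b using Fin.cases with
    | zero => exact absurd hab (not_le.2 (Fin.succ_pos a))
    | succ b =>
      rw [omega_cons_succ]
      exact (mem_uPQ_iff_isSkew e X).1 hX a b (Fin.succ_le_succ_iff.1 hab)

theorem diagMat_zero_smul_one (N : ℕ) (r : ℝ) : diagMat (N := N) 0 (r • 1) =
    ((r : ℂ) * Complex.I) • (1 : Matrix (Fin (N + 1)) (Fin (N + 1)) ℂ) := by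
  rw [diagMat_def, Matrix.smul_one_eq_diagonal]
  simp

/-- The average of the imaginary parts of the diagonal entries of the affine matrix. -/
def meanIm (m : ℕ) (X : Matrix (Fin p ⊕ Fin q) (Fin p ⊕ Fin q) ℂ) : ℝ :=
  (((m + 1 : ℕ) : ℝ) + 1)⁻¹ * X.trace.im

theorem lie_sub_smul_one {n : Type} [Fintype n] [DecidableEq n] (A B : Matrix n n ℂ) (a b : ℂ) :
    ⁅A - a • (1 : Matrix n n ℂ), B - b • (1 : Matrix n n ℂ)⁆ = A * B - B * A := by
  rw [LieRing.of_associative_ring_bracket]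
  simp only [mul_sub, sub_mul, smul_mul_assoc, mul_smul_comm, one_mul, mul_one, smul_sub]
  rw [smul_comm a b]
  abel

/-- The traceless part of an affine matrix. -/
def affineTraceless (e : Fin p ⊕ Fin q ≃ Fin (m + 1)) (v : Fin p ⊕ Fin q → ℂ)
    (X : Matrix (Fin p ⊕ Fin q) (Fin p ⊕ Fin q) ℂ) : Matrix (Fin (m + 2)) (Fin (m + 2)) ℂ :=
  affineMat e v X - diagMat 0 (meanIm m X • 1)

theorem affineTraceless_apply (e : Fin p ⊕ Fin q ≃ Fin (m + 1)) (v : Fin p ⊕ Fin q → ℂ)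
    (X : Matrix (Fin p ⊕ Fin q) (Fin p ⊕ Fin q) ℂ) (i j : Fin (m + 2)) :
    affineTraceless e v X i j = affineMat e v X i j -
      if i = j then (meanIm m X : ℂ) * Complex.I else 0 := by
  rw [affineTraceless, diagMat_zero_smul_one, Matrix.sub_apply, Matrix.smul_apply,
    Matrix.one_apply]
  simp

theorem affineTraceless_mem_ck (e : Fin p ⊕ Fin q ≃ Fin (m + 1)) (v : Fin p ⊕ Fin q → ℂ)
    {X : Matrix (Fin p ⊕ Fin q) (Fin p ⊕ Fin q) ℂ} (hX : X ∈ uPQ p q) :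
    affineTraceless e v X ∈ ck (Fin.cons 0 (signParam e)) (((m + 1 : ℕ) : ℝ) + 1)⁻¹ := by
  refine mem_ck.2 ⟨fun a b hab => ?_, ?_⟩
  · rw [affineTraceless, Matrix.sub_apply, Matrix.sub_apply, isSkew_affineMat e v hX a b hab,
      isSkew_diagMat (Fin.cons 0 (signParam e)) 0 _ a b hab, map_sub]
    ring
  · have h : ∀ a, (affineTraceless e v X a a).im = (affineMat e v X a a).im - meanIm m X := by
      intro a
      rw [affineTraceless_apply, if_pos rfl, Complex.sub_im, Complex.im_ofReal_mul, Complex.I_im,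
        mul_one]
    simp only [h]
    rw [Finset.sum_sub_distrib, sum_im_affineMat, Finset.sum_const, Finset.card_univ,
      Fintype.card_fin, nsmul_eq_mul, meanIm]
    have : ((m : ℝ) + 1 + 1) ≠ 0 := by positivity
    push_cast
    field_simp
    ring

/-- The inhomogeneous pseudo-unitary algebra maps to a special unitary Cayley--Klein algebra by
taking the traceless part of affine matrices. -/
def affineHom (e : Fin p ⊕ Fin q ≃ Fin (m + 1)) :
    IU p q →ₗ⁅ℝ⁆ ck (Fin.cons 0 (signParam e)) (((m + 1 : ℕ) : ℝ) + 1)⁻¹ where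
  toFun x := ⟨affineTraceless e x.left x.right.1, affineTraceless_mem_ck e _ x.right.2⟩
  map_add' x y := Subtype.ext (by
    change affineMat e (x.left + y.left) (x.right.1 + y.right.1) -
      diagMat 0 (meanIm m (x.right.1 + y.right.1) • 1) =
      (affineMat e x.left x.right.1 - diagMat 0 (meanIm m x.right.1 • 1)) +
      (affineMat e y.left y.right.1 - diagMat 0 (meanIm m y.right.1 • 1))
    rw [affineMat_add, meanIm, Matrix.trace_add, Complex.add_im, mul_add, add_smul, map_add,
      meanIm, meanIm]
    abel)
  map_smul' c x := Subtype.ext (by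
    change affineMat e (c • x.left) (c • x.right.1) - diagMat 0 (meanIm m (c • x.right.1) • 1) =
      c • (affineMat e x.left x.right.1 - diagMat 0 (meanIm m x.right.1 • 1))
    rw [affineMat_smul, meanIm, Matrix.trace_smul, Complex.real_smul, Complex.im_ofReal_mul,
      mul_left_comm, mul_smul, map_smul, smul_sub, meanIm])
  map_lie' {x y} := Subtype.ext (by
    change affineMat e (⁅x.left, y.left⁆ + x.right.1 *ᵥ y.left - y.right.1 *ᵥ x.left)
        (x.right.1 * y.right.1 - y.right.1 * x.right.1) -
      diagMat 0 (meanIm m (x.right.1 * y.right.1 - y.right.1 * x.right.1) • 1) =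
      ⁅affineMat e x.left x.right.1 - diagMat 0 (meanIm m x.right.1 • 1),
        affineMat e y.left y.right.1 - diagMat 0 (meanIm m y.right.1 • 1)⁆
    have h0 : ⁅x.left, y.left⁆ = 0 := by
      rw [LieRing.of_associative_ring_bracket, mul_comm, sub_self]
    -- Scalar shifts are central, and a commutator has trace zero, so its own shift vanishes.
    rw [diagMat_zero_smul_one, diagMat_zero_smul_one, diagMat_zero_smul_one, lie_sub_smul_one,
      affineMat_mul, affineMat_mul, ← affineMat_sub, meanIm, Matrix.trace_sub,
      Matrix.trace_mul_comm, sub_self, h0, zero_add]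
    simp)

theorem affineHom_apply (e : Fin p ⊕ Fin q ≃ Fin (m + 1)) (x : IU p q) (i j : Fin (m + 2)) :
    (affineHom e x).1 i j = affineMat e x.left x.right.1 i j -
      if i = j then (meanIm m x.right.1 : ℂ) * Complex.I else 0 :=
  affineTraceless_apply e x.left x.right.1 i j

theorem affineHom_injective (e : Fin p ⊕ Fin q ≃ Fin (m + 1)) :
    Function.Injective (affineHom e) := by
  rw [← LieHom.coe_toLinearMap, ← LinearMap.ker_eq_bot, LinearMap.ker_eq_bot']
  intro x hx
  have h : ∀ i j, affineMat e x.left x.right.1 i j =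
      if i = j then (meanIm m x.right.1 : ℂ) * Complex.I else 0 := by
    intro i j
    have h1 := affineHom_apply e x i j
    rw [show affineHom e x = 0 from hx] at h1
    exact (sub_eq_zero.1 h1.symm)
  -- The corner of an affine matrix is zero, so the corner of its traceless part reveals the
  -- subtracted scalar.
  have h0 : (meanIm m x.right.1 : ℂ) * Complex.I = 0 := by
    have := h 0 0
    rw [if_pos rfl] at this
    rw [← this, affineMat_zero]
  rw [h0] at h
  simp only [ite_self] at h
  have hl : x.left = 0 := by
    funext i
    simpa using h (e i).succ 0
  have hr : x.right = 0 := by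
    apply Subtype.ext
    ext i j
    simpa using h (e i).succ (e j).succ
  exact LieAlgebra.SemiDirectSum.ext hl hr

theorem affineHom_surjective (e : Fin p ⊕ Fin q ≃ Fin (m + 1)) :
    Function.Surjective (affineHom e) := by
  rintro ⟨Y, hY⟩
  obtain ⟨hs, ht⟩ := mem_ck.1 hY
  -- Adding `t * I` times the identity clears the corner of `Y` and makes it affine; `hmean` shows
  -- that this is the scalar which `affineHom` subtracts again.
  set t : ℝ := -(Y 0 0).im with ht_def
  obtain ⟨X, hXdef⟩ : ∃ X : Matrix (Fin p ⊕ Fin q) (Fin p ⊕ Fin q) ℂ, ∀ i j,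
      X i j = Y (e i).succ (e j).succ + if i = j then (t : ℂ) * Complex.I else 0 :=
    ⟨fun i j => _, fun i j => rfl⟩
  have h00 : Y 0 0 = -((t : ℂ) * Complex.I) := by
    have h1 := congrArg Complex.re (hs 0 0 le_rfl)
    rw [omega_self] at h1
    simp at h1
    apply Complex.ext
    · simp
      linarith
    · simp [ht_def]
  have hX : X ∈ uPQ p q := by
    rw [mem_uPQ_iff_isSkew e]
    intro a b hab
    have h1 := hs a.succ b.succ (Fin.succ_le_succ_iff.2 hab)
    rw [omega_cons_succ] at h1
    simp only [Matrix.submatrix_apply, hXdef, Equiv.apply_symm_apply,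
      EmbeddingLike.apply_eq_iff_eq, map_add]
    rw [h1]
    by_cases h : a = b
    · subst h
      rw [omega_self]
      simp
      ring
    · rw [if_neg h, if_neg (Ne.symm h)]
      simp
  have hmean : meanIm m X = t := by
    have h1 : ∑ a, (Y a a).im = 0 := (mul_eq_zero.1 ht).resolve_left (by positivity)
    rw [Fin.sum_univ_succ] at h1
    have h2 : X.trace.im = ∑ a : Fin (m + 1), ((Y a.succ a.succ).im + t) := by
      rw [Matrix.trace, Complex.im_sum, ← e.symm.sum_comp]
      refine Finset.sum_congr rfl fun a _ => ?_
      simp [hXdef]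
    rw [Finset.sum_add_distrib, Finset.sum_const, Finset.card_univ, Fintype.card_fin,
      nsmul_eq_mul] at h2
    rw [meanIm, inv_mul_eq_iff_eq_mul₀ (by positivity), h2]
    push_cast
    linarith
  refine ⟨⟨fun i => Y (e i).succ 0, ⟨X, hX⟩⟩, Subtype.ext ?_⟩
  ext i j
  rw [affineHom_apply]
  change affineMat e _ X i j - (if i = j then (meanIm m X : ℂ) * Complex.I else 0) = Y i j
  rw [hmean]
  induction i using Fin.cases with
  | zero =>
    induction j using Fin.cases with
    | zero => simp [h00]
    | succ b =>
      rw [hs 0 b.succ (Fin.zero_le _), omega_cons_zero, if_neg (Fin.succ_ne_zero b).symm]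
      simp
  | succ a =>
    induction j using Fin.cases with
    | zero => simp
    | succ b => simp [hXdef]

theorem card_cons_signParam_eq_zero (e : Fin p ⊕ Fin q ≃ Fin (m + 1)) :
    Nat.card {l : Fin (m + 1) // (Fin.cons 0 (signParam e) : Fin (m + 1) → ℝ) l = 0} = 1 := by
  rw [Nat.card_eq_one_iff_unique]
  have h : ∀ l : {l : Fin (m + 1) // (Fin.cons 0 (signParam e) : Fin (m + 1) → ℝ) l = 0},
      l.1 = 0 := by
    rintro ⟨l, hl⟩
    induction l using Fin.cases with
    | zero => rfl
    | succ k => exact absurd hl (signParam_ne_zero e k)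
  exact ⟨⟨fun a b => Subtype.ext ((h a).trans (h b).symm)⟩, ⟨⟨0, rfl⟩⟩⟩

theorem rank_H2_IU (h : 1 ≤ p + q) : Module.rank ℝ (H2 (IU p q)) = 1 := by
  obtain ⟨m, hm⟩ := Nat.exists_eq_succ_of_ne_zero (Nat.one_le_iff_ne_zero.1 h)
  have e := indexEquiv hm
  have E : IU p q ≃ₗ⁅ℝ⁆ ck (Fin.cons 0 (signParam e)) (((m + 1 : ℕ) : ℝ) + 1)⁻¹ :=
    LieEquiv.ofBijective (affineHom e) ⟨affineHom_injective e, affineHom_surjective e⟩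
  have h1 := rank_H2_of_equiv_ck _ E.symm
  rw [card_cons_signParam_eq_zero] at h1
  simpa using h1

end Inhomogeneous

end UnitaryCK

end

theorem proposition4p1 :
    (∀ (N : ℕ) (ω : Fin N → ℝ) (n : ℕ), n = Nat.card {k : Fin N // ω k = 0} →
      Module.rank ℝ (UnitaryCK.H2 (UnitaryCK.su ω)) = ((n * (n + 1) / 2 : ℕ) : Cardinal) ∧
      Module.rank ℝ (UnitaryCK.H2 (UnitaryCK.u ω)) = ((n * (n + 3) / 2 : ℕ) : Cardinal)) ∧
    (∀ p q : ℕ,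
      Module.rank ℝ (UnitaryCK.H2 (UnitaryCK.suPQ p q)) = 0 ∧
      Module.rank ℝ (UnitaryCK.H2 (UnitaryCK.uPQ p q)) = 0) ∧
    (∀ p q : ℕ, 1 ≤ p + q → Module.rank ℝ (UnitaryCK.H2 (UnitaryCK.IU p q)) = 1) := by
  refine ⟨fun N ω n hn => ?_, UnitaryCK.rank_H2_suPQ_uPQ, fun p q => UnitaryCK.rank_H2_IU⟩
  subst hn
  exact ⟨UnitaryCK.rank_H2_su ω, UnitaryCK.rank_H2_u ω⟩
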